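/- Let $X_1, X_2$ be independent random variables, uniform on $(0,1)$. Node 1 observes $X_1$ and node 2 observes $X_2$; the nodes may also use private randomness $W_1$, respectively $W_2$, where $W_i$ is independent of $X_i$ and $(X_1,W_1)$ is independent of $(X_2,W_2)$. Put $Y_i=(X_i,W_i)$. In an interactive protocol the nodes alternately send messages $U_1,U_2,\dots$ from a countable alphabet (node 1 sends for odd $i$, node 2 for even $i$); $U_i$ is a measurable function of the sender's observation $Y_1$ or $Y_2$ and of $U^{i-1}=(U_1,\dots,U_{i-1})$. Each node decides from its own observation and the messages so far whether to stop, and the communication ends after a random number $T$ of messages, on which there is no a priori bound. The protocol is zero-error if, with probability one, the nodes always agree on whether to stop, $T<\infty$, and after $T$ messages each node determines from its observation and $(U_1,\dots,U_T)$ whether $X_1\ge X_2$. Its communication cost is the sum rate $$R_{\mathrm{sum}}=\sum_{i\ \mathrm{odd}}H(U_i\mid U^{i-1},Y_2)+\sum_{i\ \mathrm{even}}H(U_i\mid U^{i-1},Y_1)$$ in bits, where for $i>T$ the message $U_i$ is read as blank (nothing is sent). A zero-error rectangular partition of the unit square is a countable partition of $[0,1]^2$, up to null sets, into cells $A_i\times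 B_i$ with $A_i,B_i\subseteq[0,1]$ measurable, each of which lies, up to a null set, in $\{x_1\ge x_2\}$ or in $\{x_1<x_2\}$. Its entropy is $\sum_i p_i\log_2(1/p_i)$, where $p_i$ is the area of the $i$-th cell. Theorem. (1) Every zero-error interactive protocol for deciding whether $X_1\ge X_2$ has $R_{\mathrm{sum}}\ge 4$ bits. (2) Every zero-error rectangular partition of the unit square has entropy at least $4$ bits. (3) The bit-exchange protocol, in which the nodes alternately send the successive binary digits of $X_1$ and $X_2$ and stop at the end of the first round in which the two digits differ, is zero-error, has $R_{\mathrm{sum}}=4$ bits, and sends $4$ one-bit messages on average. Hence the minimum of $R_{\mathrm{sum}}$ over all zero-error protocols is exactly $4$ bits; likewise the minimum entropy of a zero-error rectangular partition is exactly $4$ bits. -/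

import Mathlib

open MeasureTheory ProbabilityTheory
open scoped ENNReal

noncomputable section

namespace MinComm

/-! ### Entropy, in bits -/

/-- The contribution `p * log₂ (1 / p)` (and `0` for `p = 0`) of a probability `p`. -/
def bitsOf (p : ℝ) : ℝ≥0∞ := ENNReal.ofReal (Real.negMulLog p / Real.log 2)

/-- The conditional entropy `H(M | 𝓖) = E[∑ₐ P(M = a | 𝓖) log₂ (1 / P(M = a | 𝓖))]`, in bits,
of a discrete random variable `M` given a sub-σ-algebra `𝓖`. -/
def condEntropy {Ω γ : Type*} {mΩ : MeasurableSpace Ω} (μ : Measure Ω) (M : Ω → γ)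
    (𝓖 : MeasurableSpace Ω) : ℝ≥0∞ :=
  ∫⁻ ω, ∑' a, bitsOf ((μ[(M ⁻¹' {a}).indicator (fun _ => (1 : ℝ)) | 𝓖]) ω) ∂μ

/-! ### Interactive protocols -/

/-- A two-party interactive protocol with an unbounded number of messages. Node 1 observes an
element of `α`, node 2 an element of `β`. The nodes send messages in turn, node 1 first; a message
is a symbol of the countable alphabet `ℕ` and is a function of the sender's observation and of the
list `h` of all earlier messages (most recent first). From its observation and `h` each node also
decides whether the communication is over, and computes its output. -/
structure Protocol (α β : Type*) [MeasurableSpace α] [MeasurableSpace β] where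
  send₁ : List ℕ → α → ℕ
  send₂ : List ℕ → β → ℕ
  stop₁ : List ℕ → α → Bool
  stop₂ : List ℕ → β → Bool
  out₁ : List ℕ → α → Bool
  out₂ : List ℕ → β → Bool
  measurable_send₁ : ∀ h, Measurable (send₁ h)
  measurable_send₂ : ∀ h, Measurable (send₂ h)
  measurable_stop₁ : ∀ h, Measurable (stop₁ h)
  measurable_stop₂ : ∀ h, Measurable (stop₂ h)
  measurable_out₁ : ∀ h, Measurable (out₁ h)
  measurable_out₂ : ∀ h, Measurable (out₂ h)

namespace Protocol

variable {α β : Type*} [MeasurableSpace α] [MeasurableSpace β]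

/-- What is sent after the messages `h`: nothing if the nodes stop, and otherwise the message of
the node whose turn it is. -/
def next (P : Protocol α β) (h : List ℕ) (x : α) (y : β) : Option ℕ :=
  if P.stop₁ h x = true ∧ P.stop₂ h y = true then none
  else if Even h.length then some (P.send₁ h x) else some (P.send₂ h y)

/-- The list (most recent first) of the messages sent in the first `n` steps. It has length `n` as
long as the communication goes on, and no longer changes once the nodes have stopped. -/
def transcript (P : Protocol α β) (x : α) (y : β) : ℕ → List ℕ
  | 0 => []
  | n + 1 => (P.next (P.transcript x y n) x y).toList ++ P.transcript x y n

/-- The total number of messages sent, `∞` if the nodes never stop. -/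
def numMessages (P : Protocol α β) (x : α) (y : β) : ℝ≥0∞ :=
  ⨆ n, ((P.transcript x y n).length : ℝ≥0∞)

variable {Ω : Type*} [MeasurableSpace Ω]

/-- With probability one, the two nodes always agree on whether to stop, they stop after finitely
many steps, and when they stop each of them outputs whether `F` holds. -/
def ZeroError (P : Protocol α β) (μ : Measure Ω) (Y₁ : Ω → α) (Y₂ : Ω → β)
    (F : Ω → Prop) : Prop :=
  ∀ᵐ ω ∂μ,
    (∀ n, P.stop₁ (P.transcript (Y₁ ω) (Y₂ ω) n) (Y₁ ω)
        = P.stop₂ (P.transcript (Y₁ ω) (Y₂ ω) n) (Y₂ ω)) ∧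
    ∃ n, P.stop₁ (P.transcript (Y₁ ω) (Y₂ ω) n) (Y₁ ω) = true ∧
      (P.out₁ (P.transcript (Y₁ ω) (Y₂ ω) n) (Y₁ ω) = true ↔ F ω) ∧
      (P.out₂ (P.transcript (Y₁ ω) (Y₂ ω) n) (Y₂ ω) = true ↔ F ω)

/-- The σ-algebra of what the receiver of the message of step `n` (steps are numbered from `0`)
knows before that step: the messages sent so far, and its own observation, which is `Y₂` when `n`
is even (node 1 sends) and `Y₁` when `n` is odd (node 2 sends). -/
@[reducible] def receiverInfo (P : Protocol α β) (Y₁ : Ω → α) (Y₂ : Ω → β) (n : ℕ) : MeasurableSpace Ω :=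
  MeasurableSpace.comap (fun ω => P.transcript (Y₁ ω) (Y₂ ω) n) ⊤ ⊔
    (if Even n then MeasurableSpace.comap Y₂ inferInstance
      else MeasurableSpace.comap Y₁ inferInstance)

/-- The sum rate, in bits: the sum over all steps of the conditional entropy of what is sent in
that step, given what the receiver already knows. -/
def sumRate (P : Protocol α β) (μ : Measure Ω) (Y₁ : Ω → α) (Y₂ : Ω → β) : ℝ≥0∞ :=
  ∑' n, condEntropy μ (fun ω => P.next (P.transcript (Y₁ ω) (Y₂ ω) n) (Y₁ ω) (Y₂ ω))
    (P.receiverInfo Y₁ Y₂ n)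

end Protocol

/-! ### The bit-exchange protocol -/

/-- The binary digit of `x` with weight `2⁻¹ ^ (k + 1)`, for `0 ≤ x < 1`. -/
def bit (x : ℝ) (k : ℕ) : ℕ := ⌊x * 2 ^ (k + 1)⌋₊ % 2

theorem measurable_bit (k : ℕ) : Measurable fun x : ℝ => bit x k :=
  (Measurable.of_discrete (f := fun n : ℕ => n % 2)).comp
    (Nat.measurable_floor.comp (measurable_id.mul_const _))

/-- At the end of a round (two messages), the two bits of that round differ. -/
def lastBitsDiffer : List ℕ → Bool
  | b :: a :: h => decide (Even h.length ∧ a ≠ b)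
  | _ => false

/-- The bit that node 1 sent in the last complete round is `1`. -/
def lastBitOne : List ℕ → Bool
  | _ :: a :: _ => decide (a = 1)
  | _ => false

/-- Node 1 and node 2 send the binary digits of their numbers in turn, and stop at the end of the
first round in which the two digits differ. The second component of an observation (private
randomness) is not used. -/
def bitExchange (S₁ S₂ : Type*) [MeasurableSpace S₁] [MeasurableSpace S₂] :
    Protocol (ℝ × S₁) (ℝ × S₂) where
  send₁ h x := bit x.1 (h.length / 2)
  send₂ h y := bit y.1 (h.length / 2)
  stop₁ h _ := lastBitsDiffer h
  stop₂ h _ := lastBitsDiffer h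
  out₁ h _ := lastBitOne h
  out₂ h _ := lastBitOne h
  measurable_send₁ _ := (measurable_bit _).comp measurable_fst
  measurable_send₂ _ := (measurable_bit _).comp measurable_fst
  measurable_stop₁ _ := measurable_const
  measurable_stop₂ _ := measurable_const
  measurable_out₁ _ := measurable_const
  measurable_out₂ _ := measurable_const

/-! ### Rectangular partitions of the unit square -/

/-- A countable partition (up to null sets) of the unit square into cells that are Cartesian
products of measurable sets. Cells may be empty, so finite partitions are included. -/
structure RectPartition where
  left : ℕ → Set ℝ
  right : ℕ → Set ℝ
  measurableSet_left : ∀ i, MeasurableSet (left i)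
  measurableSet_right : ∀ i, MeasurableSet (right i)
  left_subset : ∀ i, left i ⊆ Set.Icc 0 1
  right_subset : ∀ i, right i ⊆ Set.Icc 0 1
  aedisjoint : ∀ i j, i ≠ j →
    volume ((left i ×ˢ right i) ∩ (left j ×ˢ right j) : Set (ℝ × ℝ)) = 0
  cover : volume ((Set.Icc 0 1 ×ˢ Set.Icc 0 1 : Set (ℝ × ℝ)) \ ⋃ i, left i ×ˢ right i) = 0

namespace RectPartition

def cell (R : RectPartition) (i : ℕ) : Set (ℝ × ℝ) := R.left i ×ˢ R.right i

/-- Up to null sets, each cell lies in `{x₁ ≥ x₂}` or in `{x₁ < x₂}`. -/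
def ZeroError (R : RectPartition) : Prop :=
  ∀ i, volume (R.cell i ∩ {x | x.1 < x.2}) = 0 ∨ volume (R.cell i ∩ {x | x.2 ≤ x.1}) = 0

/-- The entropy, in bits, of the cell probabilities. -/
def entropy (R : RectPartition) : ℝ≥0∞ := ∑' i, bitsOf (volume.real (R.cell i))

end RectPartition

end MinComm

end

noncomputable section

namespace MinComm

/-! Give the unit square the weight w(x, y) = 2 log (1 / |x - y|) + 4 log 2 in nats (`cellWeight`).
Its integral over the square is 3 + 4 log 2. The heart of the proof is the cell inequality
`cell_bound`: over a zero-error rectangle of area p, the integral of w is at most p log (1 / p) + 3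
p. Summed over a partition, the areas total 1, the 3's cancel, and H log 2 ≥ 4 log 2 remains.

For the cell inequality, the two sides of a zero-error rectangle are separated by some t
(`exists_separating`). The kernel decreases with distance, so for given side lengths a and b its
integral is largest when the sides are intervals meeting at t; this is the bathtub principle in each
variable (`lintegral_lintegral_logKernel_le`). For such intervals the integral is explicit, and the
claim becomes h(q) ≥ 4 log 2 · q (1 - q) at q = a / (a + b), where h is the binary entropy in nats.
Equality holds at q = 1 / 2, that is, for squares touching the diagonal at a corner, so the dyadic
partition into such squares attains 4 bits.

In a protocol, the event that a given transcript occurs is a rectangle up to a null set, because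
both nodes agree on stopping and each message depends only on its sender. Hence, given the
transcript, the next message is independent of the receiver's observation, the conditional entropies
telescope, and the sum rate is the supremum of the transcript entropies
(`Protocol.sumRate_eq_iSup_entropyOf`). Stopped transcripts are zero-error cells. Private randomness
makes their side laws measures dominated by Lebesgue measure rather than restrictions of it to sets,
which is why `cell_bound` is about measures.

In bit exchange, every transcript of length l that occurs has probability 2 ^ (-l), so the entropy
is the mean length. A round follows k agreeing rounds with probability 2 ^ (-k) and costs two
messages: 4 in total. -/

/-! ### A lower bound for the binary entropy function -/

/-- The excess of the binary entropy function over the parabola with the same values at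
`0`, `1 / 2` and `1`. -/
def binEntropyExcess (p : ℝ) : ℝ := Real.binEntropy p - 4 * Real.log 2 * (p * (1 - p))

theorem continuous_binEntropyExcess : Continuous binEntropyExcess := by
  unfold binEntropyExcess
  fun_prop

theorem hasDerivAt_binEntropyExcess {p : ℝ} (h0 : 0 < p) (h1 : p < 1) :
    HasDerivAt binEntropyExcess
      (Real.log (1 - p) - Real.log p - 4 * Real.log 2 * (1 - 2 * p)) p := by
  have h := (Real.hasDerivAt_binEntropy h0.ne' h1.ne).sub
    (((hasDerivAt_id p).mul ((hasDerivAt_const p 1).sub (hasDerivAt_id p))).const_mul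
      (4 * Real.log 2))
  refine h.congr_deriv ?_
  simp only [id, Pi.sub_apply]
  ring

theorem hasDerivAt_deriv_binEntropyExcess {p : ℝ} (h0 : 0 < p) (h1 : p < 1) :
    HasDerivAt (fun p => Real.log (1 - p) - Real.log p - 4 * Real.log 2 * (1 - 2 * p))
      (8 * Real.log 2 - 1 / (p * (1 - p))) p := by
  have h1' : 1 - p ≠ 0 := by linarith
  have h := ((((hasDerivAt_const p 1).sub (hasDerivAt_id p)).log h1').sub
    (Real.hasDerivAt_log h0.ne')).sub
      ((((hasDerivAt_const p (1 : ℝ)).sub ((hasDerivAt_id p).const_mul 2))).const_mul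
      (4 * Real.log 2))
  refine h.congr_deriv ?_
  simp only [id, Pi.sub_apply]
  field_simp
  ring

theorem deriv2_binEntropyExcess {p : ℝ} (h0 : 0 < p) (h1 : p < 1) :
    deriv^[2] binEntropyExcess p = 8 * Real.log 2 - 1 / (p * (1 - p)) := by
  have : deriv binEntropyExcess =ᶠ[nhds p]
      fun p => Real.log (1 - p) - Real.log p - 4 * Real.log 2 * (1 - 2 * p) := by
    filter_upwards [Ioo_mem_nhds h0 h1] with q hq
    exact (hasDerivAt_binEntropyExcess hq.1 hq.2).deriv
  simp only [Function.iterate_succ, Function.iterate_zero, Function.comp, id]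
  rw [this.deriv_eq, (hasDerivAt_deriv_binEntropyExcess h0 h1).deriv]

theorem binEntropyExcess_one_sub (p : ℝ) : binEntropyExcess (1 - p) = binEntropyExcess p := by
  simp only [binEntropyExcess, Real.binEntropy_one_sub]
  ring

theorem binEntropyExcess_half : binEntropyExcess 2⁻¹ = 0 := by
  simp only [binEntropyExcess, Real.binEntropy_two_inv]
  ring

/-- The second derivative changes sign at c. On `[c, 1 - c]` the excess is convex and symmetric
about 1 / 2, so its minimum is the value 0 at 1 / 2. On `[0, c]` it is concave, and nonnegative at
both ends. -/
theorem binEntropyExcess_nonneg_of_le_half {p : ℝ} (h0 : 0 ≤ p) (h1 : p ≤ 1 / 2) :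
    0 ≤ binEntropyExcess p := by
  have hl : 0.6931471803 < Real.log 2 := Real.log_two_gt_d9
  -- The smaller zero of the second derivative; the quadratic has real roots because log 2 > 1 / 2.
  obtain ⟨c, hc0, hc1, hc⟩ : ∃ c : ℝ, 0 < c ∧ c < 1 / 2 ∧ 8 * Real.log 2 * (c * (1 - c)) = 1 := by
    have hr : 0 < 1 - 1 / (2 * Real.log 2) := by
      rw [sub_pos, div_lt_one (by positivity)]
      linarith
    have hr1 : √(1 - 1 / (2 * Real.log 2)) < 1 := by
      rw [Real.sqrt_lt' one_pos]
      have : 0 < 1 / (2 * Real.log 2) := by positivity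
      linarith
    refine ⟨(1 - √(1 - 1 / (2 * Real.log 2))) / 2, by linarith, ?_, ?_⟩
    · have := Real.sqrt_pos.2 hr
      linarith
    · have h2 := Real.sq_sqrt hr.le
      generalize √(1 - 1 / (2 * Real.log 2)) = s at h2
      have : 8 * Real.log 2 * ((1 - s) / 2 * (1 - (1 - s) / 2)) = 2 * Real.log 2 * (1 - s ^ 2) := by
        ring
      rw [this, h2]
      field_simp
      ring
  have hcc : 0 < c * (1 - c) := mul_pos hc0 (by linarith)
  have key : ∀ q : ℝ, c ≤ q → q ≤ 1 / 2 → 0 ≤ binEntropyExcess q := by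
    intro q hq hq2
    have hconv : ConvexOn ℝ (Set.Icc c (1 - c)) binEntropyExcess := by
      refine convexOn_of_deriv2_nonneg (convex_Icc _ _) continuous_binEntropyExcess.continuousOn
        ?_ ?_ ?_
      · intro x hx
        rw [interior_Icc] at hx
        exact (hasDerivAt_binEntropyExcess (hc0.trans hx.1)
          (by linarith [hx.2])).differentiableAt.differentiableWithinAt
      · intro x hx
        rw [interior_Icc] at hx
        have hx0 := hc0.trans hx.1
        have hx1 : x < 1 := by linarith [hx.2]
        refine ((hasDerivAt_deriv_binEntropyExcess hx0
          hx1).differentiableAt.congr_of_eventuallyEq ?_).differentiableWithinAt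
        filter_upwards [Ioo_mem_nhds hx0 hx1] with y hy
        exact (hasDerivAt_binEntropyExcess hy.1 hy.2).deriv
      · intro x hx
        rw [interior_Icc] at hx
        have hx0 := hc0.trans hx.1
        have hx1 : x < 1 := by linarith [hx.2]
        rw [deriv2_binEntropyExcess hx0 hx1, sub_nonneg, div_le_iff₀ (mul_pos hx0 (by linarith))]
        refine hc.ge.trans (mul_le_mul_of_nonneg_left ?_ (by positivity))
        nlinarith [mul_pos (sub_pos.2 hx.1) (sub_pos.2 hx.2)]
    have hq' : q ∈ Set.Icc c (1 - c) := ⟨hq, by linarith⟩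
    have hq'' : 1 - q ∈ Set.Icc c (1 - c) := ⟨by linarith, by linarith⟩
    have := hconv.2 hq' hq'' (by norm_num : (0 : ℝ) ≤ 2⁻¹) (by norm_num : (0 : ℝ) ≤ 2⁻¹)
      (by norm_num)
    rw [binEntropyExcess_one_sub] at this
    have e : (2⁻¹ : ℝ) • q + (2⁻¹ : ℝ) • (1 - q) = 2⁻¹ := by
      simp only [smul_eq_mul]
      ring
    rw [e, binEntropyExcess_half] at this
    simp only [smul_eq_mul] at this
    linarith
  rcases le_total c p with h | h
  · exact key p h h1
  · have hconc : ConcaveOn ℝ (Set.Icc 0 c) binEntropyExcess := by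
      refine concaveOn_of_deriv2_nonpos (convex_Icc _ _) continuous_binEntropyExcess.continuousOn
        ?_ ?_ ?_
      · intro x hx
        rw [interior_Icc] at hx
        exact (hasDerivAt_binEntropyExcess hx.1
          (by linarith [hx.2])).differentiableAt.differentiableWithinAt
      · intro x hx
        rw [interior_Icc] at hx
        have hx1 : x < 1 := by linarith [hx.2]
        refine ((hasDerivAt_deriv_binEntropyExcess hx.1
          hx1).differentiableAt.congr_of_eventuallyEq ?_).differentiableWithinAt
        filter_upwards [Ioo_mem_nhds hx.1 hx1] with y hy
        exact (hasDerivAt_binEntropyExcess hy.1 hy.2).deriv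
      · intro x hx
        rw [interior_Icc] at hx
        have hx1 : x < 1 := by linarith [hx.2]
        rw [deriv2_binEntropyExcess hx.1 hx1, sub_nonpos,
          le_div_iff₀ (mul_pos hx.1 (by linarith))]
        refine (mul_le_mul_of_nonneg_left ?_ (by positivity)).trans hc.le
        nlinarith [mul_pos (sub_pos.2 hx.2) (show 0 < 1 - c - x by linarith [hx.2])]
    -- Concavity along the chord from 0 to c, with p as the convex combination of weight p / c.
    have := hconc.2 (Set.left_mem_Icc.2 hc0.le) (Set.right_mem_Icc.2 hc0.le)
      (sub_nonneg.2 ((div_le_one hc0).2 h)) (by positivity : 0 ≤ p / c) (by ring)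
    have e : (1 - p / c) • (0 : ℝ) + (p / c) • c = p := by
      simp only [smul_eq_mul]
      field_simp
      ring
    rw [e] at this
    have h00 : binEntropyExcess 0 = 0 := by simp [binEntropyExcess]
    rw [h00, smul_zero, zero_add, smul_eq_mul] at this
    exact (mul_nonneg (by positivity) (key c le_rfl hc1.le)).trans this

theorem four_mul_log_two_mul_le_binEntropy {p : ℝ} (h0 : 0 ≤ p) (h1 : p ≤ 1) :
    4 * Real.log 2 * (p * (1 - p)) ≤ Real.binEntropy p := by
  rw [← sub_nonneg]
  change 0 ≤ binEntropyExcess p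
  rcases le_total p (1 / 2) with h | h
  · exact binEntropyExcess_nonneg_of_le_half h0 h
  · rw [← binEntropyExcess_one_sub]
    exact binEntropyExcess_nonneg_of_le_half (by linarith) (by linarith)

/-- The entropy bound at a / (a + b), multiplied by (a + b)²; this homogeneous form is what the cell
inequality reduces to. -/
theorem add_mul_log_add_ge {a b : ℝ} (ha : 0 < a) (hb : 0 < b) :
    (a + b) * (a * Real.log a + b * Real.log b) + 4 * Real.log 2 * (a * b)
      ≤ (a + b) ^ 2 * Real.log (a + b) := by
  have hab : 0 < a + b := by positivity
  have h := four_mul_log_two_mul_le_binEntropy (p := a / (a + b)) (by positivity)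
    ((div_le_one hab).2 (by linarith))
  have e : 1 - a / (a + b) = b / (a + b) := by
    field_simp
    ring
  rw [Real.binEntropy, e, Real.log_inv, Real.log_inv, Real.log_div ha.ne' hab.ne',
    Real.log_div hb.ne' hab.ne'] at h
  have h2 := mul_le_mul_of_nonneg_left h (sq_nonneg (a + b))
  have e1 : (a + b) ^ 2 * (4 * Real.log 2 * (a / (a + b) * (b / (a + b))))
      = 4 * Real.log 2 * (a * b) := by
    field_simp
  have e2 : (a + b) ^ 2 * (a / (a + b) * -(Real.log a - Real.log (a + b))
      + b / (a + b) * -(Real.log b - Real.log (a + b)))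
      = (a + b) ^ 2 * Real.log (a + b) - (a + b) * (a * Real.log a + b * Real.log b) := by
    field_simp
    ring
  rw [e1, e2] at h2
  linarith

/-! ### The logarithmic kernel -/

/-- The kernel `log (1 / |x - y|)`, in nats. -/
def logKernel (x y : ℝ) : ℝ≥0∞ := ENNReal.ofReal (-Real.log (x - y))

theorem measurable_logKernel : Measurable fun z : ℝ × ℝ => logKernel z.1 z.2 :=
  (Real.measurable_log.comp (measurable_fst.sub measurable_snd)).neg.ennreal_ofReal

theorem logKernel_comm (x y : ℝ) : logKernel x y = logKernel y x := by
  rw [logKernel, logKernel, ← Real.log_neg_eq_log, neg_sub]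

theorem logKernel_anti {u v w z : ℝ} (h0 : 0 < u - v) (h : u - v ≤ w - z) :
    logKernel w z ≤ logKernel u v :=
  ENNReal.ofReal_le_ofReal (neg_le_neg (Real.log_le_log h0 h))

/-- An antiderivative of `-log`. -/
def logPrim (w : ℝ) : ℝ := w + Real.negMulLog w

/-- An antiderivative of `logPrim`. -/
def logPrim₂ (w : ℝ) : ℝ := 3 / 4 * w ^ 2 + w * Real.negMulLog w / 2

@[fun_prop]
theorem continuous_logPrim : Continuous logPrim := by
  unfold logPrim
  fun_prop

theorem continuous_logPrim₂ : Continuous logPrim₂ := by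
  unfold logPrim₂
  fun_prop

theorem integral_neg_log (a b : ℝ) : ∫ s in a..b, -Real.log s = logPrim b - logPrim a := by
  rw [intervalIntegral.integral_neg, integral_log, logPrim, logPrim, Real.negMulLog, Real.negMulLog]
  ring

theorem integral_logPrim {a b : ℝ} (ha : 0 ≤ a) (hab : a ≤ b) :
    ∫ s in a..b, logPrim s = logPrim₂ b - logPrim₂ a := by
  refine intervalIntegral.integral_eq_sub_of_hasDerivAt_of_le hab continuous_logPrim₂.continuousOn
    ?_ (continuous_logPrim.intervalIntegrable _ _)
  intro x hx
  have hx0 : x ≠ 0 := (ha.trans_lt hx.1).ne'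
  have h := (((hasDerivAt_id x).pow 2).const_mul (3 / 4)).add
    (((hasDerivAt_id x).mul (Real.hasDerivAt_negMulLog hx0)).div_const 2)
  refine h.congr_deriv ?_
  simp only [id, logPrim, Real.negMulLog, Nat.cast_ofNat]
  ring

theorem lintegral_Ioo_eq_integral {f : ℝ → ℝ} {c d : ℝ} (hcd : c ≤ d)
    (hf : IntervalIntegrable f volume c d) (h0 : ∀ x ∈ Set.Ioo c d, 0 ≤ f x) :
    ∫⁻ x in Set.Ioo c d, ENNReal.ofReal (f x) = ENNReal.ofReal (∫ x in c..d, f x) := by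
  rw [intervalIntegral.integral_of_le hcd, integral_Ioc_eq_integral_Ioo,
    ofReal_integral_eq_lintegral_ofReal]
  · exact ((intervalIntegrable_iff_integrableOn_Ioo_of_le hcd).1 hf)
  · exact (ae_restrict_iff' measurableSet_Ioo).2 (Filter.Eventually.of_forall h0)

/-- Distances stay at most 1, where the logarithm is nonpositive and the truncation by
`ENNReal.ofReal` in `logKernel` loses nothing. -/
theorem lintegral_logKernel_left {y c d : ℝ} (hy : y ≤ c) (hcd : c ≤ d) (hd : d - y ≤ 1) :
    ∫⁻ x in Set.Ioo c d, logKernel x y = ENNReal.ofReal (logPrim (d - y) - logPrim (c - y)) := by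
  unfold logKernel
  rw [lintegral_Ioo_eq_integral (f := fun x => -Real.log (x - y)) hcd,
    intervalIntegral.integral_comp_sub_right (fun x => -Real.log x) y, integral_neg_log]
  · have := (intervalIntegral.intervalIntegrable_log' (a := c - y) (b := d - y)).neg.comp_sub_right y
    simpa using this
  · intro x hx
    exact neg_nonneg.2 (Real.log_nonpos (by linarith [hx.1]) (by linarith [hx.2]))

theorem logPrim_le_logPrim {c d : ℝ} (hc : 0 ≤ c) (hcd : c ≤ d) (hd : d ≤ 1) :
    logPrim c ≤ logPrim d := by
  rw [← sub_nonneg, ← integral_neg_log]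
  refine intervalIntegral.integral_nonneg hcd fun x hx => ?_
  exact neg_nonneg.2 (Real.log_nonpos (by linarith [hx.1]) (by linarith [hx.2]))

/-- The integral of the logarithmic kernel over an `a × b` rectangle touching the diagonal. -/
theorem lintegral_logKernel_rect {t a b : ℝ} (ha : 0 ≤ a) (hb : 0 ≤ b) (hab : a + b ≤ 1) :
    ∫⁻ y in Set.Ioo (t - b) t, ∫⁻ x in Set.Ioo t (t + a), logKernel x y
      = ENNReal.ofReal (logPrim₂ (a + b) - logPrim₂ a - logPrim₂ b) := by
  have e : ∀ y ∈ Set.Ioo (t - b) t, ∫⁻ x in Set.Ioo t (t + a), logKernel x y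
      = ENNReal.ofReal (logPrim (t + a - y) - logPrim (t - y)) := fun y hy =>
    lintegral_logKernel_left hy.2.le (by linarith) (by linarith [hy.1])
  rw [setLIntegral_congr_fun measurableSet_Ioo e, lintegral_Ioo_eq_integral (by linarith)]
  · rw [intervalIntegral.integral_sub, intervalIntegral.integral_comp_sub_left logPrim (t + a),
      intervalIntegral.integral_comp_sub_left logPrim t, integral_logPrim (by linarith) (by linarith),
      integral_logPrim (by linarith) (by linarith)]
    · congr 1
      have : logPrim₂ 0 = 0 := by simp [logPrim₂]
      rw [show t + a - (t - b) = a + b by ring, show t + a - t = a by ring,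
        show t - (t - b) = b by ring, sub_self, this]
      ring
    · exact Continuous.intervalIntegrable (by fun_prop) _ _
    · exact Continuous.intervalIntegrable (by fun_prop) _ _
  · exact Continuous.intervalIntegrable (by fun_prop) _ _
  · intro y hy
    rw [sub_nonneg]
    exact logPrim_le_logPrim (by linarith [hy.2]) (by linarith) (by linarith [hy.1])

/-- The diagonal cuts each line at y into two pieces that contribute `logPrim y` and `logPrim (1 -
y)`. Each integrates to `logPrim₂ 1` = 3 / 4. -/
theorem lintegral_logKernel_unit :
    ∫⁻ y in Set.Ioo (0 : ℝ) 1, ∫⁻ x in Set.Ioo (0 : ℝ) 1, logKernel x y = ENNReal.ofReal (3 / 2) := by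
  have e : ∀ y ∈ Set.Ioo (0 : ℝ) 1, ∫⁻ x in Set.Ioo (0 : ℝ) 1, logKernel x y
      = ENNReal.ofReal (logPrim y + logPrim (1 - y)) := by
    intro y hy
    have h0 : logPrim 0 = 0 := by simp [logPrim]
    have hsplit : Set.Ioo (0 : ℝ) 1 =ᵐ[volume] (Set.Ioo 0 y ∪ Set.Ioo y 1 : Set ℝ) := by
      rw [← Set.Ioc_union_Ioo_eq_Ioo hy.1.le hy.2]
      exact Filter.EventuallyEq.union Ioo_ae_eq_Ioc.symm Filter.EventuallyEq.rfl
    rw [setLIntegral_congr hsplit, lintegral_union measurableSet_Ioo, add_comm,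
      lintegral_logKernel_left le_rfl hy.2.le (by linarith [hy.1])]
    · have : ∫⁻ x in Set.Ioo 0 y, logKernel x y = ENNReal.ofReal (logPrim y) := by
        have h := lintegral_Ioo_eq_integral (f := fun x => -Real.log (y - x)) hy.1.le ?_ ?_
        · rw [intervalIntegral.integral_comp_sub_left (fun x => -Real.log x) y, integral_neg_log,
            sub_self, h0, sub_zero, sub_zero] at h
          rw [← h]
          exact lintegral_congr fun x => logKernel_comm x y
        · have := (intervalIntegral.intervalIntegrable_log'
            (a := y - 0) (b := y - y)).neg.comp_sub_left y
          simpa using this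
        · intro x hx
          exact neg_nonneg.2 (Real.log_nonpos (by linarith [hx.2]) (by linarith [hx.1, hy.2]))
      rw [this, sub_self, h0, sub_zero, ← ENNReal.ofReal_add, add_comm]
      · rw [← h0]; exact logPrim_le_logPrim le_rfl (by linarith [hy.2]) (by linarith [hy.1])
      · rw [← h0]; exact logPrim_le_logPrim le_rfl hy.1.le hy.2.le
    · rw [Set.disjoint_left]
      intro x hx hx'
      exact lt_asymm hx.2 hx'.1
  rw [setLIntegral_congr_fun measurableSet_Ioo e, lintegral_Ioo_eq_integral zero_le_one]
  · rw [intervalIntegral.integral_add, intervalIntegral.integral_comp_sub_left logPrim 1,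
      sub_self, sub_zero, integral_logPrim le_rfl zero_le_one]
    · congr 1
      simp only [logPrim₂, Real.negMulLog_one, Real.negMulLog_zero]
      norm_num
    · exact Continuous.intervalIntegrable (by fun_prop) _ _
    · exact Continuous.intervalIntegrable (by fun_prop) _ _
  · exact Continuous.intervalIntegrable (by fun_prop) _ _
  · intro y hy
    have h0 : logPrim 0 = 0 := by simp [logPrim]
    refine add_nonneg ?_ ?_
    · rw [← h0]; exact logPrim_le_logPrim le_rfl hy.1.le hy.2.le
    · rw [← h0]; exact logPrim_le_logPrim le_rfl (by linarith [hy.2]) (by linarith [hy.1])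

/-! ### The cell inequality -/

/-- The bathtub principle. -/
theorem lintegral_le_setLIntegral_of_measure_le {α : Type*} [MeasurableSpace α] {ρ ν : Measure α}
    [IsFiniteMeasure ρ]
    (hρ : ρ ≤ ν) {I : Set α} (hI : MeasurableSet I) (hIν : ν I = ρ Set.univ) {g : α → ℝ≥0∞}
    {c : ℝ≥0∞} (h₁ : ∀ x ∈ I, c ≤ g x) (h₂ : ∀ᵐ x ∂ρ, x ∉ I → g x ≤ c) :
    ∫⁻ x, g x ∂ρ ≤ ∫⁻ x in I, g x ∂ν := by
  have hle : ρ.restrict I ≤ ν.restrict I := Measure.restrict_mono le_rfl hρ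
  have hd : ν.restrict I = ν.restrict I - ρ.restrict I + ρ.restrict I :=
    (Measure.sub_add_cancel_of_le hle).symm
  have hνI : ν I ≠ ∞ := hIν ▸ measure_ne_top _ _
  rw [← lintegral_add_compl g hI, hd, lintegral_add_measure, add_comm]
  refine add_le_add ?_ le_rfl
  -- The mass of ρ outside I equals the room that ρ leaves below ν inside I. Moving it there takes
  -- it from where g ≤ c to where g ≥ c.
  calc ∫⁻ x in Iᶜ, g x ∂ρ ≤ ∫⁻ _ in Iᶜ, c ∂ρ :=
        lintegral_mono_ae ((ae_restrict_iff' hI.compl).2 h₂)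
    _ = c * ρ Iᶜ := by rw [setLIntegral_const]
    _ = c * (ν.restrict I - ρ.restrict I) Set.univ := by
        rw [Measure.sub_apply MeasurableSet.univ hle, Measure.restrict_apply_univ,
          Measure.restrict_apply_univ, measure_compl hI (measure_ne_top _ _), hIν]
    _ = ∫⁻ _, c ∂(ν.restrict I - ρ.restrict I) := by rw [lintegral_const]
    _ ≤ ∫⁻ x, g x ∂(ν.restrict I - ρ.restrict I) := by
        refine lintegral_mono_ae ?_
        have : ν.restrict I - ρ.restrict I ≤ ν.restrict I := Measure.sub_le
        exact this.absolutelyContinuous (ae_restrict_of_forall_mem hI h₁)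

theorem measure_univ_eq_ofReal {ρ : Measure ℝ} [IsFiniteMeasure ρ] :
    ρ Set.univ = ENNReal.ofReal (ρ.real Set.univ) := by simp

/-- Density at most 1 limits how tightly mass can be packed against t, and the kernel grows as
points on opposite sides of t approach it. The bathtub principle packs first ρ₁, against the
potential of ρ₂, and then ρ₂, against the potential of the interval that replaced ρ₁. -/
theorem lintegral_lintegral_logKernel_le {ρ₁ ρ₂ : Measure ℝ} [IsFiniteMeasure ρ₁]
    [IsFiniteMeasure ρ₂] (h₁ : ρ₁ ≤ volume) (h₂ : ρ₂ ≤ volume) {t : ℝ}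
    (ht₁ : ∀ᵐ x ∂ρ₁, t ≤ x) (ht₂ : ∀ᵐ y ∂ρ₂, y ≤ t) :
    ∫⁻ x, ∫⁻ y, logKernel x y ∂ρ₂ ∂ρ₁
      ≤ ∫⁻ y in Set.Ioo (t - ρ₂.real Set.univ) t, ∫⁻ x in Set.Ioo t (t + ρ₁.real Set.univ),
          logKernel x y := by
  set a := ρ₁.real Set.univ with ha_def
  set b := ρ₂.real Set.univ with hb_def
  have hb0 : 0 ≤ b := measureReal_nonneg
  have ha0 : 0 ≤ a := measureReal_nonneg
  -- The point t itself is outside the open intervals although it is not far from t; it is discarded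
  -- as a null set.
  have hne : ∀ {ρ : Measure ℝ}, ρ ≤ volume → ∀ s : ℝ, ∀ᵐ x ∂ρ, x ≠ s := fun h s =>
    h.absolutelyContinuous (Measure.ae_ne volume s)
  -- A positive a keeps t + a at positive distance from every y ≤ t. This matters because `Real.log
  -- 0 = 0` makes the kernel vanish on the diagonal, where monotonicity fails.
  rcases ha0.eq_or_lt with ha | ha
  · have : ρ₁ = 0 := by
      rw [← Measure.measure_univ_eq_zero, measure_univ_eq_ofReal, ← ha_def, ← ha,
        ENNReal.ofReal_zero]
    simp [this]
  rcases hb0.eq_or_lt with hb | hb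
  · have : ρ₂ = 0 := by
      rw [← Measure.measure_univ_eq_zero, measure_univ_eq_ofReal, ← hb_def, ← hb,
        ENNReal.ofReal_zero]
    simp [this]
  have step₁ : ∫⁻ x, ∫⁻ y, logKernel x y ∂ρ₂ ∂ρ₁
      ≤ ∫⁻ x in Set.Ioo t (t + a), ∫⁻ y, logKernel x y ∂ρ₂ := by
    refine lintegral_le_setLIntegral_of_measure_le (c := ∫⁻ y, logKernel (t + a) y ∂ρ₂) h₁
      measurableSet_Ioo ?_ ?_ ?_
    · rw [Real.volume_Ioo, measure_univ_eq_ofReal, add_sub_cancel_left]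
    · intro x hx
      refine lintegral_mono_ae ?_
      filter_upwards [ht₂] with y hy
      exact logKernel_anti (by linarith [hx.1]) (by linarith [hx.2])
    · filter_upwards [ht₁, hne h₁ t] with x hx hxt hxI
      have hx' : t + a ≤ x := by
        by_contra! hc
        exact hxI ⟨lt_of_le_of_ne hx hxt.symm, hc⟩
      refine lintegral_mono_ae ?_
      filter_upwards [ht₂] with y hy
      exact logKernel_anti (by linarith) (by linarith)
  refine step₁.trans ?_
  rw [lintegral_lintegral_swap measurable_logKernel.aemeasurable]
  refine lintegral_le_setLIntegral_of_measure_le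
    (c := ∫⁻ x in Set.Ioo t (t + a), logKernel x (t - b)) h₂ measurableSet_Ioo ?_ ?_ ?_
  · rw [Real.volume_Ioo, measure_univ_eq_ofReal, sub_sub_cancel]
  · intro y hy
    refine setLIntegral_mono' measurableSet_Ioo fun x hx => ?_
    exact logKernel_anti (by linarith [hx.1, hy.2]) (by linarith [hy.1])
  · filter_upwards [ht₂, hne h₂ t] with y hy hyt hyI
    have hy' : y ≤ t - b := by
      by_contra! hc
      exact hyI ⟨hc, lt_of_le_of_ne hy hyt⟩
    refine setLIntegral_mono' measurableSet_Ioo fun x hx => ?_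
    exact logKernel_anti (by linarith [hx.1]) (by linarith)

/-- The density whose integral over a zero-error cell bounds the contribution of that cell to the
entropy, in nats, up to three times its area. -/
def cellWeight (z : ℝ × ℝ) : ℝ≥0∞ := 2 * logKernel z.1 z.2 + ENNReal.ofReal (4 * Real.log 2)

theorem measurable_cellWeight : Measurable cellWeight :=
  (measurable_logKernel.const_mul 2).add_const _

theorem cellWeight_swap (z : ℝ × ℝ) : cellWeight z.swap = cellWeight z := by
  rw [cellWeight, cellWeight, Prod.fst_swap, Prod.snd_swap, logKernel_comm]

theorem lintegral_cellWeight_unit :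
    ∫⁻ z, cellWeight z ∂((volume.restrict (Set.Ioo (0 : ℝ) 1)).prod
      (volume.restrict (Set.Ioo (0 : ℝ) 1))) = 3 + ENNReal.ofReal (4 * Real.log 2) := by
  have h : ∫⁻ z, logKernel z.1 z.2 ∂((volume.restrict (Set.Ioo (0 : ℝ) 1)).prod
      (volume.restrict (Set.Ioo (0 : ℝ) 1))) = ENNReal.ofReal (3 / 2) := by
    rw [lintegral_prod_symm _ measurable_logKernel.aemeasurable, ← lintegral_logKernel_unit]
  unfold cellWeight
  rw [lintegral_add_right _ measurable_const, lintegral_const_mul _ measurable_logKernel, h,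
    lintegral_const, ← Set.univ_prod_univ, Measure.prod_prod]
  simp only [Measure.restrict_apply_univ, Real.volume_Ioo, sub_zero, ENNReal.ofReal_one, mul_one]
  congr 1
  rw [← ENNReal.ofReal_ofNat 2, ← ENNReal.ofReal_mul (by norm_num), ← ENNReal.ofReal_ofNat 3]
  norm_num

theorem ofReal_log_two_mul_bitsOf (p : ℝ) :
    ENNReal.ofReal (Real.log 2) * bitsOf p = ENNReal.ofReal (Real.negMulLog p) := by
  have h2 : 0 < Real.log 2 := Real.log_pos one_lt_two
  rw [bitsOf, ← ENNReal.ofReal_mul h2.le, mul_div_cancel₀ _ h2.ne']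

/-- After both sides are packed against t, the kernel integral depends only on the masses a and b,
and the claim is the elementary inequality `add_mul_log_add_ge`. -/
theorem cell_bound_of_separated {ρ₁ ρ₂ : Measure ℝ}
    (h₁ : ρ₁ ≤ volume.restrict (Set.Icc 0 1)) (h₂ : ρ₂ ≤ volume.restrict (Set.Icc 0 1)) {t : ℝ}
    (ht₁ : ∀ᵐ x ∂ρ₁, t ≤ x) (ht₂ : ∀ᵐ y ∂ρ₂, y ≤ t) :
    ∫⁻ z, cellWeight z ∂(ρ₁.prod ρ₂)
      ≤ ENNReal.ofReal (Real.log 2) * bitsOf (ρ₁.real Set.univ * ρ₂.real Set.univ)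
        + 3 * ENNReal.ofReal (ρ₁.real Set.univ * ρ₂.real Set.univ) := by
  have : IsFiniteMeasure ρ₁ := isFiniteMeasure_of_le _ h₁
  have : IsFiniteMeasure ρ₂ := isFiniteMeasure_of_le _ h₂
  have h₁' := h₁.trans Measure.restrict_le_self
  have h₂' := h₂.trans Measure.restrict_le_self
  have hmain := lintegral_lintegral_logKernel_le h₁' h₂' ht₁ ht₂
  have hI₁ : ∀ᵐ x ∂ρ₁, x ∈ Set.Icc (0 : ℝ) 1 :=
    h₁.absolutelyContinuous (ae_restrict_mem measurableSet_Icc)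
  have hI₂ : ∀ᵐ x ∂ρ₂, x ∈ Set.Icc (0 : ℝ) 1 :=
    h₂.absolutelyContinuous (ae_restrict_mem measurableSet_Icc)
  set a := ρ₁.real Set.univ with ha_def
  set b := ρ₂.real Set.univ with hb_def
  have hb0 : 0 ≤ b := measureReal_nonneg
  have ha0 : 0 ≤ a := measureReal_nonneg
  have hprod : (ρ₁.prod ρ₂) Set.univ = ENNReal.ofReal (a * b) := by
    rw [← Set.univ_prod_univ, Measure.prod_prod, measure_univ_eq_ofReal,
      measure_univ_eq_ofReal, ENNReal.ofReal_mul ha0]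
  by_cases hab0 : a * b = 0
  · rw [hab0, ENNReal.ofReal_zero, Measure.measure_univ_eq_zero] at hprod
    simp [hprod]
  have ha : 0 < a := ha0.lt_of_ne fun h => hab0 (by rw [← h, zero_mul])
  have hb : 0 < b := hb0.lt_of_ne fun h => hab0 (by rw [← h, mul_zero])
  -- A measure of density at most 1 has mass at most the length of an interval that carries it. With
  -- the carriers [t, 1] and [0, t] this gives a + b ≤ 1, as the rectangle formula requires.
  have le_of_ae : ∀ {ρ : Measure ℝ} [IsFiniteMeasure ρ], ρ ≤ volume → 0 < ρ.real Set.univ →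
      ∀ {u v : ℝ}, (∀ᵐ x ∂ρ, x ∈ Set.Icc u v) → ρ.real Set.univ ≤ v - u := by
    intro ρ _ hρ hpos u v hae
    have h : ρ Set.univ ≤ ENNReal.ofReal (v - u) := by
      rw [← Real.volume_Icc]
      refine le_trans (le_of_eq ?_) (hρ (Set.Icc u v))
      exact (measure_congr (Filter.eventuallyEq_univ.2 hae)).symm
    rw [measure_univ_eq_ofReal] at h
    by_contra! hc
    exact absurd h (not_le.2 ((ENNReal.ofReal_lt_ofReal_iff hpos).2 hc))
  have hat : a ≤ 1 - t := le_of_ae h₁' ha (by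
    filter_upwards [ht₁, hI₁] with x hx hx' using ⟨hx, hx'.2⟩)
  have hbt : b ≤ t - 0 := le_of_ae h₂' hb (by
    filter_upwards [ht₂, hI₂] with x hx hx' using ⟨hx'.1, hx⟩)
  rw [lintegral_logKernel_rect ha0 hb0 (by linarith)] at hmain
  unfold cellWeight
  rw [lintegral_add_right _ measurable_const, lintegral_const_mul _ measurable_logKernel,
    lintegral_prod _ measurable_logKernel.aemeasurable, lintegral_const, hprod,
    ofReal_log_two_mul_bitsOf]
  have hl2 : 0 < Real.log 2 := Real.log_pos one_lt_two
  -- Superadditivity of `logPrim₂`, since its derivative `logPrim` increases on [0, 1].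
  have hJ : 0 ≤ logPrim₂ (a + b) - logPrim₂ a - logPrim₂ b := by
    have hK := integral_logPrim hb0 (by linarith : b ≤ a + b)
    have hK' := integral_logPrim le_rfl ha0
    have h3 : ∫ s in (0 : ℝ)..a, (logPrim (s + b) - logPrim s)
        = logPrim₂ (a + b) - logPrim₂ a - logPrim₂ b := by
      rw [intervalIntegral.integral_sub, intervalIntegral.integral_comp_add_right logPrim b,
        zero_add, hK, hK']
      · have : logPrim₂ 0 = 0 := by simp [logPrim₂]
        rw [this]
        ring
      · exact Continuous.intervalIntegrable (by fun_prop) _ _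
      · exact Continuous.intervalIntegrable (by fun_prop) _ _
    rw [← h3]
    refine intervalIntegral.integral_nonneg ha0 fun x hx => ?_
    exact sub_nonneg.2 (logPrim_le_logPrim hx.1 (by linarith) (by linarith [hx.2]))
  have hm1 : a * b ≤ 1 := mul_le_one₀ (by linarith) hb0 (by linarith)
  calc _ ≤ 2 * ENNReal.ofReal (logPrim₂ (a + b) - logPrim₂ a - logPrim₂ b)
        + ENNReal.ofReal (4 * Real.log 2) * ENNReal.ofReal (a * b) := by gcongr
    _ = ENNReal.ofReal (2 * (logPrim₂ (a + b) - logPrim₂ a - logPrim₂ b)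
        + 4 * Real.log 2 * (a * b)) := by
        rw [ENNReal.ofReal_add (by positivity) (by positivity), ENNReal.ofReal_mul two_pos.le,
          ENNReal.ofReal_mul (p := 4 * Real.log 2) (by positivity), ENNReal.ofReal_ofNat]
    _ ≤ ENNReal.ofReal (Real.negMulLog (a * b) + 3 * (a * b)) := by
        refine ENNReal.ofReal_le_ofReal ?_
        -- The quadratic parts of `logPrim₂` contribute exactly 3 a b on the left and cancel the 3 a
        -- b on the right; only logarithmic terms remain.
        have := add_mul_log_add_ge ha hb
        simp only [logPrim₂, Real.negMulLog, Real.log_mul ha.ne' hb.ne']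
        linarith
    _ = _ := by
        rw [ENNReal.ofReal_add (Real.negMulLog_nonneg (by positivity) hm1) (by positivity),
          ENNReal.ofReal_mul (p := 3) (by norm_num), ENNReal.ofReal_ofNat]

/-- The witness is the essential infimum of ρ₁. For every u above it, ρ₁ charges the points below u,
so the null product set forces ρ₂ to give no mass to the points from u on. -/
theorem exists_separating {ρ₁ ρ₂ : Measure ℝ} [SFinite ρ₂]
    (h₁ : ∀ᵐ x ∂ρ₁, x ∈ Set.Icc (0 : ℝ) 1)
    (h : (ρ₁.prod ρ₂) {z | z.1 < z.2} = 0) (h0 : ρ₁ ≠ 0) :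
    ∃ t : ℝ, (∀ᵐ x ∂ρ₁, t ≤ x) ∧ ∀ᵐ y ∂ρ₂, y ≤ t := by
  set S : Set ℝ := {s | ρ₁ (Set.Iio s) = 0} with hS
  have hne : S.Nonempty := by
    refine ⟨0, measure_mono_null (fun x (hx : x < 0) => ?_) h₁⟩
    exact fun hx' => absurd hx'.1 (not_le.2 hx)
  have hbdd : BddAbove S := by
    -- Any bound from 1 on would serve: beyond it, `Iio s` contains the whole interval carrying ρ₁ ≠
    -- 0.
    refine ⟨2, fun s hs => ?_⟩
    by_contra! hc
    refine h0 (Measure.measure_univ_eq_zero.1 ?_)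
    refine measure_mono_null (t := Set.Iio s ∪ {x | ¬ x ∈ Set.Icc (0 : ℝ) 1}) (fun x _ => ?_)
      (measure_union_null hs h₁)
    by_cases hx : x ∈ Set.Icc (0 : ℝ) 1
    · exact Or.inl (show x < s by linarith [hx.2])
    · exact Or.inr hx
  refine ⟨sSup S, ?_, ?_⟩
  · rw [ae_iff]
    simp only [not_le]
    obtain ⟨u, -, hulim, huS⟩ := exists_seq_tendsto_sSup hne hbdd
    refine measure_mono_null (t := ⋃ n, Set.Iio (u n)) (fun x (hx : x < sSup S) => ?_)
      (measure_iUnion_null huS)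
    obtain ⟨n, hn⟩ := (hulim.eventually (lt_mem_nhds hx)).exists
    exact Set.mem_iUnion.2 ⟨n, hn⟩
  · rw [ae_iff]
    simp only [not_le]
    obtain ⟨u, -, hu, hulim⟩ := exists_seq_strictAnti_tendsto (sSup S)
    refine measure_mono_null (t := ⋃ n, Set.Ici (u n)) (fun x (hx : sSup S < x) => ?_)
      (measure_iUnion_null fun n => ?_)
    · obtain ⟨n, hn⟩ := (hulim.eventually (gt_mem_nhds hx)).exists
      exact Set.mem_iUnion.2 ⟨n, hn.le⟩
    · have hpos : ρ₁ (Set.Iio (u n)) ≠ 0 := fun hn =>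
        absurd (le_csSup hbdd (show u n ∈ S from hn)) (not_le.2 (hu n))
      have : (ρ₁.prod ρ₂) (Set.Iio (u n) ×ˢ Set.Ici (u n)) = 0 :=
        measure_mono_null (fun z hz => show z.1 < z.2 from lt_of_lt_of_le hz.1 hz.2) h
      rw [Measure.prod_prod, mul_eq_zero] at this
      exact this.resolve_left hpos

theorem cell_bound_of_null {ρ₁ ρ₂ : Measure ℝ}
    (h₁ : ρ₁ ≤ volume.restrict (Set.Icc 0 1)) (h₂ : ρ₂ ≤ volume.restrict (Set.Icc 0 1))
    (h : (ρ₁.prod ρ₂) {z | z.1 < z.2} = 0) :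
    ∫⁻ z, cellWeight z ∂(ρ₁.prod ρ₂)
      ≤ ENNReal.ofReal (Real.log 2) * bitsOf (ρ₁.real Set.univ * ρ₂.real Set.univ)
        + 3 * ENNReal.ofReal (ρ₁.real Set.univ * ρ₂.real Set.univ) := by
  have : IsFiniteMeasure ρ₂ := isFiniteMeasure_of_le _ h₂
  by_cases h0 : ρ₁ = 0
  · simp [h0]
  obtain ⟨t, ht₁, ht₂⟩ := exists_separating
    (h₁.absolutelyContinuous (ae_restrict_mem measurableSet_Icc)) h h0
  exact cell_bound_of_separated h₁ h₂ ht₁ ht₂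

/-- The cell inequality: a zero-error cell whose side laws are `ρ₁` and `ρ₂`. -/
theorem cell_bound {ρ₁ ρ₂ : Measure ℝ}
    (h₁ : ρ₁ ≤ volume.restrict (Set.Icc 0 1)) (h₂ : ρ₂ ≤ volume.restrict (Set.Icc 0 1))
    (h : (ρ₁.prod ρ₂) {z | z.1 < z.2} = 0 ∨ (ρ₁.prod ρ₂) {z | z.2 ≤ z.1} = 0) :
    ∫⁻ z, cellWeight z ∂(ρ₁.prod ρ₂)
      ≤ ENNReal.ofReal (Real.log 2) * bitsOf (ρ₁.real Set.univ * ρ₂.real Set.univ)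
        + 3 * ENNReal.ofReal (ρ₁.real Set.univ * ρ₂.real Set.univ) := by
  have : IsFiniteMeasure ρ₁ := isFiniteMeasure_of_le _ h₁
  have : IsFiniteMeasure ρ₂ := isFiniteMeasure_of_le _ h₂
  rcases h with h | h
  · exact cell_bound_of_null h₁ h₂ h
  -- Reflection in the diagonal exchanges the two kinds of cell and preserves the weight. The weak
  -- inequality in the hypothesis gives more than the strict one needed.
  · rw [← Measure.prod_swap, lintegral_map measurable_cellWeight measurable_swap,
      mul_comm (ρ₁.real _)]
    simp only [cellWeight_swap]
    refine cell_bound_of_null h₂ h₁ ?_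
    rw [← Measure.prod_swap, Measure.map_apply measurable_swap
      (measurableSet_lt measurable_fst measurable_snd)]
    exact measure_mono_null (fun z (hz : z.2 < z.1) => hz.le) h

/-! ### Rectangular partitions: the lower bound -/

theorem four_le_of_weight_le {H : ℝ≥0∞}
    (h : 3 + ENNReal.ofReal (4 * Real.log 2) ≤ ENNReal.ofReal (Real.log 2) * H + 3) : 4 ≤ H := by
  have h2 : 0 < Real.log 2 := Real.log_pos one_lt_two
  rw [add_comm] at h
  have h' := (ENNReal.add_le_add_iff_right (by norm_num)).1 h
  rw [mul_comm 4, ENNReal.ofReal_mul h2.le, ENNReal.ofReal_ofNat] at h'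
  exact (ENNReal.mul_le_mul_iff_right (ENNReal.ofReal_pos.2 h2).ne' ENNReal.ofReal_ne_top).1 h'

theorem lintegral_cellWeight_Icc :
    ∫⁻ z in (Set.Icc 0 1 ×ˢ Set.Icc 0 1 : Set (ℝ × ℝ)), cellWeight z
      = 3 + ENNReal.ofReal (4 * Real.log 2) := by
  rw [Measure.volume_eq_prod, ← Measure.prod_restrict, ← lintegral_cellWeight_unit,
    restrict_Ioo_eq_restrict_Icc]

theorem RectPartition.four_le_entropy (R : RectPartition) (hR : R.ZeroError) : 4 ≤ R.entropy := by
  have hmeas : ∀ i, MeasurableSet (R.cell i) := fun i =>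
    (R.measurableSet_left i).prod (R.measurableSet_right i)
  have hcell : ∀ i, ∫⁻ z in R.cell i, cellWeight z
      ≤ ENNReal.ofReal (Real.log 2) * bitsOf (volume.real (R.cell i)) + 3 * volume (R.cell i) := by
    intro i
    have hp : (volume.restrict (R.left i)).prod (volume.restrict (R.right i))
        = volume.restrict (R.cell i) := by
      rw [Measure.prod_restrict, ← Measure.volume_eq_prod]
      rfl
    have h := cell_bound (ρ₁ := volume.restrict (R.left i)) (ρ₂ := volume.restrict (R.right i))
      (Measure.restrict_mono (R.left_subset i) le_rfl)
      (Measure.restrict_mono (R.right_subset i) le_rfl) ?_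
    · have hreal : volume.real (R.cell i)
          = (volume.restrict (R.left i)).real Set.univ
            * (volume.restrict (R.right i)).real Set.univ := by
        rw [measureReal_restrict_apply_univ, measureReal_restrict_apply_univ, cell,
          Measure.volume_eq_prod, measureReal_prod_prod]
      have hfin : volume (R.cell i) ≠ ∞ := by
        refine ne_top_of_le_ne_top ?_ (measure_mono (Set.prod_mono (R.left_subset i)
          (R.right_subset i)))
        rw [Measure.volume_eq_prod, Measure.prod_prod]
        simp
      rw [hp, ← hreal, ofReal_measureReal hfin] at h
      exact h
    · rw [hp, Measure.restrict_apply (measurableSet_lt measurable_fst measurable_snd),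
        Measure.restrict_apply (measurableSet_le measurable_snd measurable_fst)]
      simpa only [Set.inter_comm] using hR i
  have hsub : (⋃ i, R.cell i) ⊆ (Set.Icc 0 1 ×ˢ Set.Icc 0 1 : Set (ℝ × ℝ)) :=
    Set.iUnion_subset fun i => Set.prod_mono (R.left_subset i) (R.right_subset i)
  have hunion : (⋃ i, R.cell i) =ᵐ[volume] (Set.Icc 0 1 ×ˢ Set.Icc 0 1 : Set (ℝ × ℝ)) := by
    refine Filter.EventuallyLE.antisymm hsub.eventuallyLE ?_
    rw [ae_le_set]
    exact R.cover
  -- Almost disjointness enters only here; for the integral of the weight, countable subadditivity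
  -- is enough.
  have hvol : ∑' i, volume (R.cell i) = 1 := by
    rw [← measure_iUnion₀ (f := R.cell) (fun i j hij => R.aedisjoint i j hij)
      (fun i => (hmeas i).nullMeasurableSet), measure_congr hunion, Measure.volume_eq_prod,
      Measure.prod_prod]
    simp
  refine four_le_of_weight_le ?_
  calc 3 + ENNReal.ofReal (4 * Real.log 2) = ∫⁻ z in ⋃ i, R.cell i, cellWeight z := by
        rw [setLIntegral_congr hunion, lintegral_cellWeight_Icc]
    _ ≤ ∑' i, ∫⁻ z in R.cell i, cellWeight z := lintegral_iUnion_le _ _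
    _ ≤ ∑' i, (ENNReal.ofReal (Real.log 2) * bitsOf (volume.real (R.cell i))
          + 3 * volume (R.cell i)) := ENNReal.tsum_le_tsum hcell
    _ = ENNReal.ofReal (Real.log 2) * R.entropy + 3 := by
        rw [ENNReal.tsum_add, ENNReal.tsum_mul_left, ENNReal.tsum_mul_left, hvol, mul_one]
        rfl

/-! ### Binary digits -/

/-- The integer formed by the first `m` binary digits of `x ∈ [0, 1)`. -/
def dyadicFloor (m : ℕ) (x : ℝ) : ℕ := ⌊x * 2 ^ m⌋₊

theorem measurable_dyadicFloor (m : ℕ) : Measurable (dyadicFloor m) :=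
  Nat.measurable_floor.comp (measurable_id.mul_const _)

theorem dyadicFloor_succ_div_two (m : ℕ) (x : ℝ) :
    dyadicFloor (m + 1) x / 2 = dyadicFloor m x := by
  rw [dyadicFloor, dyadicFloor, ← Nat.floor_div_ofNat, pow_succ]
  congr 1
  ring

theorem dyadicFloor_succ (m : ℕ) (x : ℝ) :
    dyadicFloor (m + 1) x = 2 * dyadicFloor m x + bit x m := by
  rw [← dyadicFloor_succ_div_two m x]
  exact (Nat.div_add_mod (dyadicFloor (m + 1) x) 2).symm

theorem bit_lt_two (x : ℝ) (m : ℕ) : bit x m < 2 := Nat.mod_lt _ two_pos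

theorem dyadicFloor_zero {x : ℝ} (h1 : x < 1) : dyadicFloor 0 x = 0 := by
  rw [dyadicFloor, pow_zero, mul_one, Nat.floor_eq_zero]
  exact h1

theorem dyadicFloor_succ_eq_iff {m : ℕ} {x y : ℝ} :
    dyadicFloor (m + 1) x = dyadicFloor (m + 1) y
      ↔ dyadicFloor m x = dyadicFloor m y ∧ bit x m = bit y m := by
  have hx := bit_lt_two x m
  have hy := bit_lt_two y m
  rw [dyadicFloor_succ, dyadicFloor_succ]
  omega

theorem dyadicFloor_eq_of_le {m n : ℕ} (h : m ≤ n) {x y : ℝ}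
    (hxy : dyadicFloor n x = dyadicFloor n y) : dyadicFloor m x = dyadicFloor m y := by
  induction n, h using Nat.le_induction with
  | base => exact hxy
  | succ n _ ih => exact ih (dyadicFloor_succ_eq_iff.1 hxy).1

theorem dyadicFloor_mono {m : ℕ} {x y : ℝ} (h : x ≤ y) : dyadicFloor m x ≤ dyadicFloor m y :=
  Nat.floor_mono (mul_le_mul_of_nonneg_right h (by positivity))

/-- Once 2 ^ m (y - x) > 1, the scaled numbers cannot share an integer part. -/
theorem exists_dyadicFloor_ne {x y : ℝ} (hx : 0 ≤ x) (hxy : x < y) :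
    ∃ m, dyadicFloor m x ≠ dyadicFloor m y := by
  obtain ⟨m, hm⟩ := pow_unbounded_of_one_lt (1 / (y - x)) one_lt_two
  refine ⟨m, fun h => ?_⟩
  rw [div_lt_iff₀ (sub_pos.2 hxy)] at hm
  have h1 := Nat.floor_le (by positivity : 0 ≤ x * 2 ^ m)
  have h2 := Nat.lt_floor_add_one (y * 2 ^ m)
  unfold dyadicFloor at h
  rw [← h] at h2
  linarith

/-- Two different numbers of `[0, 1)` have a first binary digit where they differ. -/
theorem exists_first_bit_ne {x y : ℝ} (hx : x ∈ Set.Ico (0 : ℝ) 1) (hy : y ∈ Set.Ico (0 : ℝ) 1)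
    (hxy : x ≠ y) : ∃ m, dyadicFloor m x = dyadicFloor m y ∧ bit x m ≠ bit y m := by
  have hex : ∃ m, dyadicFloor m x ≠ dyadicFloor m y := by
    rcases lt_or_gt_of_ne hxy with h | h
    · exact exists_dyadicFloor_ne hx.1 h
    · exact (exists_dyadicFloor_ne hy.1 h).imp fun _ => Ne.symm
  classical
  obtain ⟨k, hk⟩ : ∃ k, Nat.find hex = k + 1 := by
    refine Nat.exists_eq_succ_of_ne_zero fun h0 => ?_
    have := Nat.find_spec hex
    rw [h0, dyadicFloor_zero hx.2, dyadicFloor_zero hy.2] at this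
    exact this rfl
  have h1 : dyadicFloor k x = dyadicFloor k y := by
    by_contra hc
    have := Nat.find_min' hex hc
    omega
  refine ⟨k, h1, fun h => ?_⟩
  have := Nat.find_spec hex
  rw [hk] at this
  exact this (dyadicFloor_succ_eq_iff.2 ⟨h1, h⟩)

/-- With equal prefixes, digit m alone orders the floors at level m + 1, and these floors are
monotone in the number. -/
theorem bit_eq_one_iff_of_first_ne {x y : ℝ} {m : ℕ} (h : dyadicFloor m x = dyadicFloor m y)
    (hne : bit x m ≠ bit y m) : bit x m = 1 ↔ y < x := by
  have hx := bit_lt_two x m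
  have hy := bit_lt_two y m
  have ex := dyadicFloor_succ m x
  have ey := dyadicFloor_succ m y
  constructor
  · intro h1
    by_contra! hc
    have := dyadicFloor_mono (m := m + 1) hc
    omega
  · intro h1
    have := dyadicFloor_mono (m := m + 1) h1.le
    omega

/-- The `i`-th dyadic interval of length `2⁻ᵐ`. -/
def dyadicIco (m i : ℕ) : Set ℝ := Set.Ico (i / 2 ^ m) ((i + 1) / 2 ^ m)

theorem mem_dyadicIco {m i : ℕ} {x : ℝ} : x ∈ dyadicIco m i ↔ 0 ≤ x ∧ dyadicFloor m x = i := by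
  rw [dyadicIco, Set.mem_Ico, div_le_iff₀ (by positivity), lt_div_iff₀ (by positivity), dyadicFloor]
  constructor
  · intro h
    have h0 : 0 ≤ x * 2 ^ m := (Nat.cast_nonneg i).trans h.1
    exact ⟨nonneg_of_mul_nonneg_left h0 (by positivity), (Nat.floor_eq_iff h0).2 h⟩
  · rintro ⟨h0, h⟩
    exact (Nat.floor_eq_iff (by positivity)).1 h

theorem measurableSet_dyadicIco (m i : ℕ) : MeasurableSet (dyadicIco m i) := measurableSet_Ico

theorem dyadicIco_subset {m i : ℕ} (h : i < 2 ^ m) : dyadicIco m i ⊆ Set.Ico 0 1 := by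
  refine Set.Ico_subset_Ico (by positivity) ((div_le_one (by positivity)).2 ?_)
  exact_mod_cast h

theorem volume_dyadicIco (m i : ℕ) : volume (dyadicIco m i) = ENNReal.ofReal ((1 / 2) ^ m) := by
  rw [dyadicIco, Real.volume_Ico]
  congr 1
  rw [div_pow, one_pow]
  ring

theorem dyadicFloor_lt {m : ℕ} {x : ℝ} (hx : x < 1) : dyadicFloor m x < 2 ^ m := by
  rw [dyadicFloor, Nat.floor_lt' (by positivity)]
  push_cast
  nlinarith [pow_pos (two_pos : (0 : ℝ) < 2) m]

theorem bitsOf_half_pow (n : ℕ) : bitsOf ((1 / 2) ^ n) = n * ENNReal.ofReal ((1 / 2) ^ n) := by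
  have h2 : Real.log 2 ≠ 0 := (Real.log_pos one_lt_two).ne'
  rw [bitsOf, Real.negMulLog, Real.log_pow, one_div, Real.log_inv, ← ENNReal.ofReal_natCast,
    ← ENNReal.ofReal_mul (Nat.cast_nonneg n)]
  congr 1
  field_simp

theorem volume_diagonal : (volume : Measure (ℝ × ℝ)) {z | z.1 = z.2} = 0 := by
  rw [Measure.volume_eq_prod,
    Measure.measure_prod_null (measurableSet_eq_fun measurable_fst measurable_snd)]
  refine Filter.Eventually.of_forall fun x => ?_
  refine measure_mono_null (t := {x}) (fun y (hy : x = y) => hy.symm) ?_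
  simp

/-! ### The dyadic partition -/

/-- The side of the dyadic cell `(k, j, b)`: the right or left half of the `j`-th dyadic interval
of length `2⁻ᵏ`, according to whether `b` is true or false. -/
def dyadicSide (c : ℕ × ℕ × Bool) : Set ℝ :=
  if c.2.1 < 2 ^ c.1 then dyadicIco (c.1 + 1) (2 * c.2.1 + c.2.2.toNat) else ∅

/-- The same cell, reflected in the diagonal. -/
def flipCell (c : ℕ × ℕ × Bool) : ℕ × ℕ × Bool := (c.1, c.2.1, !c.2.2)

theorem measurableSet_dyadicSide (c : ℕ × ℕ × Bool) : MeasurableSet (dyadicSide c) := by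
  unfold dyadicSide
  split_ifs
  · exact measurableSet_dyadicIco _ _
  · exact MeasurableSet.empty

theorem dyadicSide_subset (c : ℕ × ℕ × Bool) : dyadicSide c ⊆ Set.Icc 0 1 := by
  unfold dyadicSide
  split_ifs with h
  · refine (dyadicIco_subset ?_).trans Set.Ico_subset_Icc_self
    have : c.2.2.toNat < 2 := Bool.toNat_lt _
    rw [pow_succ]
    omega
  · exact Set.empty_subset _

theorem mem_dyadicSide {c : ℕ × ℕ × Bool} {x : ℝ} :
    x ∈ dyadicSide c ↔
      0 ≤ x ∧ c.2.1 < 2 ^ c.1 ∧ dyadicFloor c.1 x = c.2.1 ∧ bit x c.1 = c.2.2.toNat := by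
  have h1 : c.2.2.toNat < 2 := Bool.toNat_lt _
  have h2 := bit_lt_two x c.1
  have h3 := dyadicFloor_succ c.1 x
  unfold dyadicSide
  split_ifs with h
  · rw [mem_dyadicIco]
    constructor
    · rintro ⟨h0, he⟩
      exact ⟨h0, h, by omega, by omega⟩
    · rintro ⟨h0, -, he, hb⟩
      exact ⟨h0, by omega⟩
  · simp [h]

/-- A point determines its label: the level is the position of the first differing digit, the index
is the common prefix, and the Boolean is the digit of x. -/
theorem dyadicSide_prod_disjoint {c d : ℕ × ℕ × Bool} {x y : ℝ}
    (hxc : x ∈ dyadicSide c) (hyc : y ∈ dyadicSide (flipCell c))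
    (hxd : x ∈ dyadicSide d) (hyd : y ∈ dyadicSide (flipCell d)) : c = d := by
  obtain ⟨k, j, b⟩ := c
  obtain ⟨k', j', b'⟩ := d
  simp only [mem_dyadicSide, flipCell] at hxc hyc hxd hyd
  obtain ⟨-, -, h1, h2⟩ := hxc
  obtain ⟨-, -, h3, h4⟩ := hyc
  obtain ⟨-, -, h5, h6⟩ := hxd
  obtain ⟨-, -, h7, h8⟩ := hyd
  have aux : ∀ {p q : ℕ}, dyadicFloor q x = dyadicFloor q y → bit x p ≠ bit y p → q ≤ p := by
    intro p q hq hp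
    by_contra! hlt
    exact hp (dyadicFloor_succ_eq_iff.1 (dyadicFloor_eq_of_le hlt hq)).2
  have hb : bit x k ≠ bit y k := by
    rw [h2, h4]
    cases b <;> simp
  have hb' : bit x k' ≠ bit y k' := by
    rw [h6, h8]
    cases b' <;> simp
  obtain rfl : k = k' := le_antisymm (aux (h1.trans h3.symm) hb') (aux (h5.trans h7.symm) hb)
  obtain rfl : j = j' := h1.symm.trans h5
  have : b = b' := by
    rw [h2] at h6
    cases b <;> cases b' <;> simp_all
  rw [this]

theorem exists_mem_dyadicSide {x y : ℝ} (hx : x ∈ Set.Ico (0 : ℝ) 1) (hy : y ∈ Set.Ico (0 : ℝ) 1)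
    (hxy : x ≠ y) : ∃ c, x ∈ dyadicSide c ∧ y ∈ dyadicSide (flipCell c) := by
  obtain ⟨k, hk, hb⟩ := exists_first_bit_ne hx hy hxy
  have hbx := bit_lt_two x k
  have hby := bit_lt_two y k
  have hlt := dyadicFloor_lt (m := k) hx.2
  refine ⟨(k, dyadicFloor k x, decide (bit x k = 1)), ?_⟩
  rw [mem_dyadicSide, mem_dyadicSide]
  refine ⟨⟨hx.1, hlt, rfl, ?_⟩, hy.1, hlt, hk.symm, ?_⟩
  · by_cases h : bit x k = 1
    · simp [h]
    · simp only [h, decide_false, Bool.toNat_false]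
      omega
  · by_cases h : bit x k = 1
    · simp only [flipCell, h, decide_true, Bool.not_true, Bool.toNat_false]
      omega
    · simp only [flipCell, h, decide_false, Bool.not_false, Bool.toNat_true]
      omega

/-- An enumeration of the labels of the dyadic cells. -/
def cellLabel : ℕ ≃ ℕ × ℕ × Bool :=
  (nonempty_denumerable (ℕ × ℕ × Bool)).some.eqv.symm

/-- The partition of the unit square into the dyadic squares touching the diagonal. -/
def dyadicPartition : RectPartition where
  left i := dyadicSide (cellLabel i)
  right i := dyadicSide (flipCell (cellLabel i))
  measurableSet_left _ := measurableSet_dyadicSide _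
  measurableSet_right _ := measurableSet_dyadicSide _
  left_subset _ := dyadicSide_subset _
  right_subset _ := dyadicSide_subset _
  aedisjoint i j hij := by
    refine measure_mono_null (t := ∅) (fun z hz => ?_) measure_empty
    exact hij (cellLabel.injective
      (dyadicSide_prod_disjoint hz.1.1 hz.1.2 hz.2.1 hz.2.2))
  cover := by
    -- Diagonal points have no differing digit, and the coordinate 1 lies in no half-open dyadic
    -- interval; everything else is covered.
    refine measure_mono_null (t := {z : ℝ × ℝ | z.1 = z.2} ∪ ({1} ×ˢ Set.univ ∪ Set.univ ×ˢ {1}))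
      (fun z hz => ?_) (measure_union_null volume_diagonal (measure_union_null ?_ ?_))
    · by_contra hc
      simp only [Set.mem_union, Set.mem_ofPred_eq, Set.mem_prod, Set.mem_singleton_iff,
        Set.mem_univ, and_true, true_and, not_or] at hc
      obtain ⟨c, hc₁, hc₂⟩ := exists_mem_dyadicSide
        ⟨hz.1.1.1, lt_of_le_of_ne hz.1.1.2 hc.2.1⟩ ⟨hz.1.2.1, lt_of_le_of_ne hz.1.2.2 hc.2.2⟩ hc.1
      refine hz.2 (Set.mem_iUnion.2 ⟨cellLabel.symm c, ?_⟩)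
      rw [Equiv.apply_symm_apply]
      exact ⟨hc₁, hc₂⟩
    · rw [Measure.volume_eq_prod, Measure.prod_prod]
      simp
    · rw [Measure.volume_eq_prod, Measure.prod_prod]
      simp

theorem dyadicPartition_zeroError : dyadicPartition.ZeroError := by
  intro i
  set c := cellLabel i with hc
  have key : ∀ z ∈ dyadicPartition.cell i, z.1 ≠ z.2 ∧ (c.2.2 = true ↔ z.2 < z.1) := by
    rintro ⟨x, y⟩ ⟨hx, hy⟩
    change x ∈ dyadicSide c at hx
    change y ∈ dyadicSide (flipCell c) at hy
    rw [mem_dyadicSide] at hx hy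
    obtain ⟨-, -, h1, h2⟩ := hx
    obtain ⟨-, -, h3, h4⟩ := hy
    simp only [flipCell] at h3 h4
    have hne : bit x c.1 ≠ bit y c.1 := by
      rw [h2, h4]
      cases c.2.2 <;> simp
    refine ⟨fun h => hne (by rw [show x = y from h]), ?_⟩
    rw [← bit_eq_one_iff_of_first_ne (h1.trans h3.symm) hne, h2]
    cases c.2.2 <;> simp
  by_cases hb : c.2.2 = true
  · left
    refine measure_mono_null (t := ∅) (fun z hz => ?_) measure_empty
    exact lt_asymm hz.2 ((key z hz.1).2.1 hb)
  · right
    refine measure_mono_null (t := ∅) (fun z hz => ?_) measure_empty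
    exact hb ((key z hz.1).2.2 (lt_of_le_of_ne hz.2 (key z hz.1).1.symm))

theorem tsum_succ_mul_half_pow :
    ∑' k : ℕ, ((k + 1 : ℕ) : ℝ≥0∞) * ENNReal.ofReal ((1 / 2) ^ k) = 4 := by
  have h1 : HasSum (fun k : ℕ => (k : ℝ) * (1 / 2) ^ k) 2 := by
    have := hasSum_coe_mul_geometric_of_norm_lt_one (r := (1 / 2 : ℝ)) (by norm_num)
    norm_num at this ⊢
    exact this
  have h2 : HasSum (fun k : ℕ => (1 / 2 : ℝ) ^ k) 2 := hasSum_geometric_two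
  have h3 := h1.add h2
  have h4 : ∀ k : ℕ, ((k + 1 : ℕ) : ℝ≥0∞) * ENNReal.ofReal ((1 / 2) ^ k)
      = ENNReal.ofReal ((k : ℝ) * (1 / 2) ^ k + (1 / 2) ^ k) := by
    intro k
    rw [← ENNReal.ofReal_natCast, ← ENNReal.ofReal_mul (Nat.cast_nonneg _)]
    congr 1
    push_cast
    ring
  simp_rw [h4]
  rw [← ENNReal.ofReal_tsum_of_nonneg (fun k => by positivity) h3.summable, h3.tsum_eq]
  norm_num

theorem volume_dyadicSide (c : ℕ × ℕ × Bool) :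
    volume.real (dyadicSide c)
      = if c.2.1 ∈ Finset.range (2 ^ c.1) then (1 / 2) ^ (c.1 + 1) else 0 := by
  simp only [dyadicSide, Finset.mem_range]
  split_ifs
  · rw [Measure.real, volume_dyadicIco, ENNReal.toReal_ofReal (by positivity)]
  · simp

/-- Level k has 2 · 2 ^ k squares of area 4 ^ (-(k + 1)), each carrying 2 (k + 1) bits. The level
therefore contributes (k + 1) / 2 ^ k. -/
theorem dyadicPartition_entropy : dyadicPartition.entropy = 4 := by
  have hcell : ∀ c : ℕ × ℕ × Bool, bitsOf (volume.real (dyadicSide c ×ˢ dyadicSide (flipCell c)))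
      = if c.2.1 ∈ Finset.range (2 ^ c.1) then bitsOf ((1 / 2) ^ (2 * (c.1 + 1))) else 0 := by
    intro c
    rw [Measure.volume_eq_prod, measureReal_prod_prod, volume_dyadicSide, volume_dyadicSide]
    change bitsOf ((if c.2.1 ∈ Finset.range (2 ^ c.1) then (1 / 2) ^ (c.1 + 1) else 0)
      * (if c.2.1 ∈ Finset.range (2 ^ c.1) then (1 / 2) ^ (c.1 + 1) else 0)) = _
    split_ifs
    · rw [two_mul, pow_add _ (c.1 + 1)]
    · simp [bitsOf]
  have h1 : dyadicPartition.entropy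
      = ∑' c : ℕ × ℕ × Bool, bitsOf (volume.real (dyadicSide c ×ˢ dyadicSide (flipCell c))) :=
    cellLabel.tsum_eq
      (fun c => bitsOf (volume.real (dyadicSide c ×ˢ dyadicSide (flipCell c))))
  rw [h1, ← tsum_succ_mul_half_pow]
  simp_rw [hcell]
  rw [ENNReal.tsum_prod']
  refine tsum_congr fun k => ?_
  rw [ENNReal.tsum_prod']
  simp only [tsum_bool]
  rw [tsum_eq_sum (s := Finset.range (2 ^ k)) (fun j hj => by simp [hj])]
  rw [Finset.sum_congr rfl (fun j hj => by rw [if_pos hj]), Finset.sum_const, Finset.card_range,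
    bitsOf_half_pow, nsmul_eq_mul]
  simp only [← ENNReal.ofReal_natCast]
  rw [← ENNReal.ofReal_mul (by positivity), ← ENNReal.ofReal_add (by positivity) (by positivity),
    ← ENNReal.ofReal_mul (by positivity), ← ENNReal.ofReal_mul (by positivity)]
  congr 1
  push_cast
  have h2 : (2 : ℝ) ^ k * (1 / 2) ^ k = 1 := by rw [← mul_pow]; norm_num
  have h3 : (1 / 2 : ℝ) ^ (2 * (k + 1)) = (1 / 2) ^ k * (1 / 2) ^ k * (1 / 4) := by
    rw [mul_add, pow_add, two_mul, pow_add]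
    norm_num
  rw [h3]
  linear_combination ((k : ℝ) + 1) * (1 / 2) ^ k * h2

/-! ### The chain rule for entropy -/

theorem bitsOf_mul {x y : ℝ} (hx0 : 0 ≤ x) (hx1 : x ≤ 1) (hy0 : 0 ≤ y) (hy1 : y ≤ 1) :
    bitsOf (x * y) = ENNReal.ofReal y * bitsOf x + ENNReal.ofReal x * bitsOf y := by
  have h2 : 0 < Real.log 2 := Real.log_pos one_lt_two
  have hx := Real.negMulLog_nonneg hx0 hx1
  have hy := Real.negMulLog_nonneg hy0 hy1
  rw [bitsOf, bitsOf, bitsOf, ← ENNReal.ofReal_mul hy0, ← ENNReal.ofReal_mul hx0,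
    ← ENNReal.ofReal_add (by positivity) (by positivity), Real.negMulLog_mul]
  congr 1
  ring

theorem bitsOf_zero : bitsOf 0 = 0 := by simp [bitsOf]

theorem bitsOf_one : bitsOf 1 = 0 := by simp [bitsOf]

/-- The entropy, in bits, of a discrete random variable. -/
def entropyOf {Ω ι : Type*} [MeasurableSpace Ω] (μ : Measure Ω) (I : Ω → ι) : ℝ≥0∞ :=
  ∑' i, bitsOf (μ.real (I ⁻¹' {i}))

variable {Ω : Type*} [mΩ : MeasurableSpace Ω] {μ : Measure Ω}

/-- Relabelling the values of a random variable does not change its entropy. -/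
theorem entropyOf_comp {ι κ : Type*} {I : Ω → ι} {φ : ι → κ}
    (hφ : ∀ ω ω', φ (I ω) = φ (I ω') → I ω = I ω') :
    entropyOf μ (fun ω => φ (I ω)) = entropyOf μ I := by
  have hmem : ∀ i ∈ Function.support (fun i => bitsOf (μ.real (I ⁻¹' {i}))), ∃ ω, I ω = i := by
    intro i hi
    by_contra! hc
    refine hi ?_
    have : I ⁻¹' {i} = ∅ := Set.eq_empty_of_forall_notMem fun ω hω => hc ω hω
    simp [this, bitsOf_zero]
  refine tsum_eq_tsum_of_ne_zero_bij (fun i => φ i.1) ?_ ?_ ?_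
  · rintro ⟨i, hi⟩ ⟨j, hj⟩ hij
    obtain ⟨ω, rfl⟩ := hmem i hi
    obtain ⟨ω', rfl⟩ := hmem j hj
    exact Subtype.ext (hφ ω ω' hij)
  · intro k hk
    have hne : ((fun ω => φ (I ω)) ⁻¹' {k}).Nonempty := by
      by_contra hc
      rw [Set.not_nonempty_iff_eq_empty] at hc
      exact hk (by simp [hc, bitsOf_zero])
    obtain ⟨ω, rfl⟩ := hne
    refine ⟨⟨I ω, ?_⟩, rfl⟩
    have : (fun ω => φ (I ω)) ⁻¹' {φ (I ω)} = I ⁻¹' {I ω} := by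
      ext ω'
      exact ⟨fun h => hφ _ _ h, fun h => congrArg φ h⟩
    rw [Function.mem_support, this] at hk
    exact hk
  · rintro ⟨i, hi⟩
    obtain ⟨ω, rfl⟩ := hmem i hi
    congr 2
    ext ω'
    exact ⟨fun h => hφ _ _ h, fun h => congrArg φ h⟩

theorem measurable_top_of_countable {ι : Type*} [Countable ι] {H : Ω → ι}
    (hH : ∀ h, MeasurableSet (H ⁻¹' {h})) : @Measurable Ω ι mΩ ⊤ H := by
  let _ : MeasurableSpace ι := ⊤
  exact measurable_to_countable' hH

section Chain

variable {ι κ β : Type*} [mβ : MeasurableSpace β] {H : Ω → ι} {M : Ω → κ} {Y : Ω → β}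

theorem setIntegral_eq_tsum_inter_preimage [Countable ι] (hH : ∀ h, MeasurableSet (H ⁻¹' {h})) {s : Set Ω}
    (hs : MeasurableSet s) {f : Ω → ℝ} (hf : Integrable f μ) :
    ∫ ω in s, f ω ∂μ = ∑' h, ∫ ω in H ⁻¹' {h} ∩ s, f ω ∂μ := by
  have hU : s = ⋃ h, H ⁻¹' {h} ∩ s := by
    ext ω
    simp
  conv_lhs => rw [hU]
  refine integral_iUnion (fun h => (hH h).inter hs) (fun h h' hne => ?_) hf.integrableOn
  rw [Function.onFun, Set.disjoint_left]
  rintro ω ⟨h1, -⟩ ⟨h2, -⟩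
  exact hne (h1.symm.trans h2)

/-- An event of the joint σ-algebra is the preimage of a product-measurable set under (H, Y); D is
the slice of that set at h. -/
theorem exists_inter_preimage_eq {Ω : Type*} {H : Ω → ι} {Y : Ω → β} {s : Set Ω}
    (hs : MeasurableSet[MeasurableSpace.comap H ⊤ ⊔ MeasurableSpace.comap Y mβ] s) (h : ι) :
    ∃ D, MeasurableSet D ∧ H ⁻¹' {h} ∩ s = H ⁻¹' {h} ∩ Y ⁻¹' D := by
  let _ : MeasurableSpace ι := ⊤
  rw [← MeasurableSpace.comap_prodMk] at hs
  obtain ⟨E, hE, rfl⟩ := hs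
  refine ⟨Prod.mk h ⁻¹' E, measurable_prodMk_left hE, ?_⟩
  ext ω
  simp only [Set.mem_inter_iff, Set.mem_preimage, Set.mem_singleton_iff]
  constructor <;> rintro ⟨rfl, h2⟩ <;> exact ⟨rfl, h2⟩

/-- `M` and `Y` are conditionally independent given the discrete random variable `H`. -/
def CondIndepGiven (μ : Measure Ω) (H : Ω → ι) (M : Ω → κ) (Y : Ω → β) : Prop :=
  ∀ h o D, MeasurableSet D →
    μ.real (H ⁻¹' {h} ∩ M ⁻¹' {o} ∩ Y ⁻¹' D) * μ.real (H ⁻¹' {h})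
      = μ.real (H ⁻¹' {h} ∩ M ⁻¹' {o}) * μ.real (H ⁻¹' {h} ∩ Y ⁻¹' D)

/-- The candidate P(M = o | H) depends on H alone. Its integrals are tested on events cut along the
values of H, where each piece has the form {H = h, Y ∈ D} and the required identity is
`CondIndepGiven`. -/
theorem condExp_indicator_of_condIndepGiven [IsProbabilityMeasure μ] [Countable ι]
    (hH : ∀ h, MeasurableSet (H ⁻¹' {h}))
    (hM : ∀ o, MeasurableSet (M ⁻¹' {o})) (hY : Measurable Y) (hCI : CondIndepGiven μ H M Y)
    (o : κ) :
    μ[(M ⁻¹' {o}).indicator (fun _ => (1 : ℝ)) |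
        MeasurableSpace.comap H ⊤ ⊔ MeasurableSpace.comap Y mβ]
      =ᵐ[μ] fun ω => μ.real (H ⁻¹' {H ω} ∩ M ⁻¹' {o}) / μ.real (H ⁻¹' {H ω}) := by
  have hHm := measurable_top_of_countable hH
  have hle : MeasurableSpace.comap H ⊤ ⊔ MeasurableSpace.comap Y mβ ≤ mΩ :=
    sup_le hHm.comap_le hY.comap_le
  set c : ι → ℝ := fun h => μ.real (H ⁻¹' {h} ∩ M ⁻¹' {o}) / μ.real (H ⁻¹' {h}) with hc
  have hc0 : ∀ h, 0 ≤ c h := fun h => div_nonneg measureReal_nonneg measureReal_nonneg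
  have hc1 : ∀ h, c h ≤ 1 := fun h =>
    div_le_one_of_le₀ (measureReal_mono Set.inter_subset_left) measureReal_nonneg
  have hgm : Measurable[MeasurableSpace.comap H ⊤ ⊔ MeasurableSpace.comap Y mβ]
      (fun ω => c (H ω)) := by
    have h1 : @Measurable Ω ι (MeasurableSpace.comap H ⊤) ⊤ H := comap_measurable H
    have h2 : @Measurable ι ℝ ⊤ _ c := fun _ _ => trivial
    exact (h2.comp h1).mono le_sup_left le_rfl
  have hgi : Integrable (fun ω => c (H ω)) μ := by
    refine Integrable.of_bound (hgm.mono hle le_rfl).aestronglyMeasurable 1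
      (Filter.Eventually.of_forall fun ω => ?_)
    rw [Real.norm_of_nonneg (hc0 _)]
    exact hc1 _
  have hfi : Integrable ((M ⁻¹' {o}).indicator (fun _ => (1 : ℝ))) μ :=
    (integrable_const 1).indicator (hM o)
  refine (ae_eq_condExp_of_forall_setIntegral_eq hle hfi (fun _ _ _ => hgi.integrableOn) ?_
    hgm.aestronglyMeasurable).symm
  intro s hs _
  rw [setIntegral_eq_tsum_inter_preimage hH (hle s hs) hgi,
    setIntegral_eq_tsum_inter_preimage hH (hle s hs) hfi]
  refine tsum_congr fun h => ?_
  obtain ⟨D, hD, hsD⟩ := exists_inter_preimage_eq hs h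
  rw [hsD]
  have hmeas : MeasurableSet (H ⁻¹' {h} ∩ Y ⁻¹' D) := (hH h).inter (hY hD)
  have e1 : ∫ ω in H ⁻¹' {h} ∩ Y ⁻¹' D, c (H ω) ∂μ = c h * μ.real (H ⁻¹' {h} ∩ Y ⁻¹' D) := by
    rw [setIntegral_congr_fun hmeas (g := fun _ => c h)
      (fun ω hω => by rw [show H ω = h from hω.1]), setIntegral_const, smul_eq_mul, mul_comm]
  have e2 : ∫ ω in H ⁻¹' {h} ∩ Y ⁻¹' D, (M ⁻¹' {o}).indicator (fun _ => (1 : ℝ)) ω ∂μ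
      = μ.real (H ⁻¹' {h} ∩ M ⁻¹' {o} ∩ Y ⁻¹' D) := by
    rw [setIntegral_indicator (hM o), setIntegral_const, smul_eq_mul, mul_one]
    congr 1
    ext ω
    simp only [Set.mem_inter_iff]
    tauto
  rw [e1, e2]
  have hCI' := hCI h o D hD
  -- On null atoms the quotient has the default value 0, and both sides vanish.
  by_cases hp : μ.real (H ⁻¹' {h}) = 0
  · have h1 : μ.real (H ⁻¹' {h} ∩ Y ⁻¹' D) = 0 :=
      le_antisymm (hp ▸ measureReal_mono Set.inter_subset_left) measureReal_nonneg
    have h2 : μ.real (H ⁻¹' {h} ∩ M ⁻¹' {o} ∩ Y ⁻¹' D) = 0 :=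
      le_antisymm (hp ▸ measureReal_mono (Set.inter_subset_left.trans Set.inter_subset_left))
        measureReal_nonneg
    rw [h1, h2, mul_zero]
  · simp only [hc]
    rw [div_mul_eq_mul_div, ← hCI', mul_div_cancel_right₀ _ hp]

/-- The chain rule `H(H, M) = H(H) + H(M | H, Y)`, where `Y` is irrelevant given `H`. -/
theorem entropyOf_prodMk [IsProbabilityMeasure μ] [Countable ι] [Countable κ]
    (hH : ∀ h, MeasurableSet (H ⁻¹' {h}))
    (hM : ∀ o, MeasurableSet (M ⁻¹' {o})) (hY : Measurable Y) (hCI : CondIndepGiven μ H M Y) :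
    entropyOf μ (fun ω => (H ω, M ω)) = entropyOf μ H
      + condEntropy μ M (MeasurableSpace.comap H ⊤ ⊔ MeasurableSpace.comap Y mβ) := by
  set p : ι → ℝ := fun h => μ.real (H ⁻¹' {h}) with hp
  set q : ι → κ → ℝ := fun h o => μ.real (H ⁻¹' {h} ∩ M ⁻¹' {o}) with hq
  have hqp : ∀ h o, q h o ≤ p h := fun h o => measureReal_mono Set.inter_subset_left
  have hq0 : ∀ h o, 0 ≤ q h o := fun h o => measureReal_nonneg
  have hp1 : ∀ h, p h ≤ 1 := fun h => measureReal_le_one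
  have hce : condEntropy μ M (MeasurableSpace.comap H ⊤ ⊔ MeasurableSpace.comap Y mβ)
      = ∑' h, ENNReal.ofReal (p h) * ∑' o, bitsOf (q h o / p h) := by
    have hae : ∀ᵐ ω ∂μ, ∀ o, (μ[(M ⁻¹' {o}).indicator (fun _ => (1 : ℝ)) |
        MeasurableSpace.comap H ⊤ ⊔ MeasurableSpace.comap Y mβ]) ω = q (H ω) o / p (H ω) :=
      ae_all_iff.2 fun o => condExp_indicator_of_condIndepGiven hH hM hY hCI o
    have e : condEntropy μ M (MeasurableSpace.comap H ⊤ ⊔ MeasurableSpace.comap Y mβ)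
        = ∫⁻ ω, ∑' o, bitsOf (q (H ω) o / p (H ω)) ∂μ := by
      refine lintegral_congr_ae ?_
      filter_upwards [hae] with ω hω
      exact tsum_congr fun o => by rw [hω o]
    rw [e]
    let _ : MeasurableSpace ι := ⊤
    have hHm : Measurable H := measurable_top_of_countable hH
    rw [← lintegral_map (f := fun h => ∑' o, bitsOf (q h o / p h)) (fun _ _ => trivial) hHm,
      lintegral_countable']
    refine tsum_congr fun h => ?_
    rw [Measure.map_apply hHm trivial, mul_comm]
    simp [hp]
  rw [hce, entropyOf, entropyOf, ENNReal.tsum_prod', ← ENNReal.tsum_add]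
  refine tsum_congr fun h => ?_
  have hpre : ∀ o, (fun ω => (H ω, M ω)) ⁻¹' {(h, o)} = H ⁻¹' {h} ∩ M ⁻¹' {o} := by
    intro o
    ext ω
    simp
  simp_rw [hpre]
  change ∑' o, bitsOf (q h o) = bitsOf (p h) + _
  by_cases hp0 : p h = 0
  · have : ∀ o, q h o = 0 := fun o => le_antisymm (hp0 ▸ hqp h o) (hq0 h o)
    simp [this, hp0, bitsOf_zero]
  have hpos : 0 < p h := lt_of_le_of_ne measureReal_nonneg (Ne.symm hp0)
  -- The product rule for p log (1 / p), applied to q = p · (q / p). Summing over o, the conditional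
  -- probabilities q / p add up to 1 and leave `bitsOf (p h)`.
  have hsplit : ∀ o, bitsOf (q h o)
      = ENNReal.ofReal (q h o / p h) * bitsOf (p h)
        + ENNReal.ofReal (p h) * bitsOf (q h o / p h) := by
    intro o
    rw [← bitsOf_mul hpos.le (hp1 h) (div_nonneg (hq0 h o) hpos.le)
      ((div_le_one hpos).2 (hqp h o)), mul_div_cancel₀ _ hp0]
  have hsum : ∑' o, ENNReal.ofReal (q h o / p h) = 1 := by
    have h1 : ∑' o, ENNReal.ofReal (q h o) = ENNReal.ofReal (p h) := by
      simp only [hq, hp, ofReal_measureReal (measure_ne_top _ _)]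
      rw [← measure_iUnion (fun o o' hne => ?_) (fun o => (hH h).inter (hM o))]
      · congr 1
        ext ω
        simp
      · rw [Function.onFun, Set.disjoint_left]
        rintro ω ⟨-, h1⟩ ⟨-, h2⟩
        exact hne (h1.symm.trans h2)
    simp_rw [ENNReal.ofReal_div_of_pos hpos, div_eq_mul_inv]
    rw [ENNReal.tsum_mul_right, h1]
    exact ENNReal.mul_inv_cancel (ENNReal.ofReal_pos.2 hpos).ne' ENNReal.ofReal_ne_top
  simp_rw [hsplit]
  rw [ENNReal.tsum_add, ENNReal.tsum_mul_right, ENNReal.tsum_mul_left, hsum, one_mul]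

end Chain

namespace Protocol

/-! ### Transcripts -/

section Transcript

variable {α β : Type*} [MeasurableSpace α] [MeasurableSpace β] (P : Protocol α β)

/-- What is sent in step `n`. -/
def message (x : α) (y : β) (n : ℕ) : Option ℕ := P.next (P.transcript x y n) x y

theorem transcript_succ (x : α) (y : β) (n : ℕ) :
    P.transcript x y (n + 1) = (P.message x y n).toList ++ P.transcript x y n := rfl

theorem transcript_succ_of_none {x : α} {y : β} {n : ℕ} (h : P.message x y n = none) :
    P.transcript x y (n + 1) = P.transcript x y n := by
  rw [transcript_succ, h]
  rfl

theorem transcript_succ_of_some {x : α} {y : β} {n m : ℕ} (h : P.message x y n = some m) :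
    P.transcript x y (n + 1) = m :: P.transcript x y n := by
  rw [transcript_succ, h]
  rfl

theorem message_eq_none_iff {x : α} {y : β} {n : ℕ} :
    P.message x y n = none ↔
      P.stop₁ (P.transcript x y n) x = true ∧ P.stop₂ (P.transcript x y n) y = true := by
  unfold message next
  split_ifs with h1 h2 <;> simp [h1]

theorem message_succ_of_none {x : α} {y : β} {n : ℕ} (h : P.message x y n = none) :
    P.message x y (n + 1) = none := by
  rw [message, transcript_succ_of_none P h]
  exact h

theorem transcript_eq_of_none {x : α} {y : β} {n m : ℕ} (h : P.message x y n = none)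
    (hnm : n ≤ m) : P.message x y m = none ∧ P.transcript x y m = P.transcript x y n := by
  induction m, hnm using Nat.le_induction with
  | base => exact ⟨h, rfl⟩
  | succ m _ ih => exact ⟨P.message_succ_of_none ih.1, (P.transcript_succ_of_none ih.1).trans ih.2⟩

/-- Ties the turn rule of `next`, which uses the parity of the transcript length, to the step
number. -/
theorem message_eq_none_or_length (x : α) (y : β) (n : ℕ) :
    P.message x y n = none ∨ (P.transcript x y n).length = n := by
  induction n with
  | zero => exact Or.inr rfl
  | succ n ih =>
    rcases h : P.message x y n with _ | m
    · exact Or.inl (P.message_succ_of_none h)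
    · right
      rw [P.transcript_succ_of_some h, List.length_cons, ih.resolve_left (by simp [h])]

theorem length_transcript_le (x : α) (y : β) (n : ℕ) : (P.transcript x y n).length ≤ n := by
  induction n with
  | zero => exact le_rfl
  | succ n ih =>
    rcases h : P.message x y n with _ | m
    · rw [P.transcript_succ_of_none h]
      exact ih.trans (Nat.le_succ n)
    · rw [P.transcript_succ_of_some h, List.length_cons]
      exact Nat.succ_le_succ ih

/-- Splits the transcript of `n + 1` steps into that of `n` steps and the message of step `n`. -/
def splitTranscript (n : ℕ) : List ℕ → List ℕ × Option ℕ
  | [] => ([], none)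
  | m :: h => if h.length = n then (h, some m) else (m :: h, none)

theorem splitTranscript_cons (n m : ℕ) (h : List ℕ) :
    splitTranscript n (m :: h) = if h.length = n then (h, some m) else (m :: h, none) := rfl

theorem splitTranscript_toList_append (n : ℕ) (h : List ℕ) :
    (splitTranscript n h).2.toList ++ (splitTranscript n h).1 = h := by
  cases h with
  | nil => rfl
  | cons m h =>
    rw [splitTranscript_cons]
    split_ifs <;> rfl

/-- Stopping leaves no symbol in the list, but the length n + 1 is reached exactly when step n sends
something. So no information is lost in passing from the pair to the longer transcript. -/
theorem splitTranscript_transcript (x : α) (y : β) (n : ℕ) :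
    splitTranscript n (P.transcript x y (n + 1)) = (P.transcript x y n, P.message x y n) := by
  rcases h : P.message x y n with _ | m
  · rw [P.transcript_succ_of_none h]
    have := P.length_transcript_le x y n
    cases h' : P.transcript x y n with
    | nil => rfl
    | cons m t =>
      rw [h', List.length_cons] at this
      rw [splitTranscript_cons, if_neg (by omega)]
  · rw [P.transcript_succ_of_some h]
    have := (P.message_eq_none_or_length x y n).resolve_left (by simp [h])
    rw [splitTranscript_cons, if_pos this]

theorem transcript_succ_eq_iff (x : α) (y : β) (n : ℕ) (h : List ℕ) :
    P.transcript x y (n + 1) = h ↔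
      P.transcript x y n = (splitTranscript n h).1 ∧
        P.message x y n = (splitTranscript n h).2 := by
  constructor
  · rintro rfl
    rw [P.splitTranscript_transcript]
    exact ⟨rfl, rfl⟩
  · rintro ⟨h1, h2⟩
    rw [transcript_succ, h1, h2, splitTranscript_toList_append]

end Transcript

/-! ### Measurability -/

section Measurable

variable {α β : Type*} [MeasurableSpace α] [MeasurableSpace β] (P : Protocol α β)
  {Ω : Type*} [MeasurableSpace Ω] {Y₁ : Ω → α} {Y₂ : Ω → β}

theorem measurableSet_next_eq (hY₁ : Measurable Y₁) (hY₂ : Measurable Y₂) (h : List ℕ)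
    (o : Option ℕ) : MeasurableSet {ω | P.next h (Y₁ ω) (Y₂ ω) = o} := by
  have hs : MeasurableSet {ω | P.stop₁ h (Y₁ ω) = true ∧ P.stop₂ h (Y₂ ω) = true} :=
    (((P.measurable_stop₁ h).comp hY₁) (measurableSet_singleton true)).inter
      (((P.measurable_stop₂ h).comp hY₂) (measurableSet_singleton true))
  rcases o with _ | m
  · convert hs using 2 with ω
    unfold next
    split_ifs with h1 <;> simp
  · by_cases he : Even h.length
    · convert hs.compl.inter (((P.measurable_send₁ h).comp hY₁) (measurableSet_singleton m)) using 1
      ext ω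
      unfold next
      simp only [Set.mem_ofPred_eq, Set.mem_inter_iff, Set.mem_compl_iff, Set.mem_preimage,
        Function.comp, Set.mem_singleton_iff]
      split_ifs with h1 <;> simp [h1]
    · convert hs.compl.inter (((P.measurable_send₂ h).comp hY₂) (measurableSet_singleton m)) using 1
      ext ω
      unfold next
      simp only [Set.mem_ofPred_eq, Set.mem_inter_iff, Set.mem_compl_iff, Set.mem_preimage,
        Function.comp, Set.mem_singleton_iff]
      split_ifs with h1 <;> simp [h1]

theorem measurableSet_transcript_message (hY₁ : Measurable Y₁) (hY₂ : Measurable Y₂) {n : ℕ}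
    {h : List ℕ} (hh : MeasurableSet {ω | P.transcript (Y₁ ω) (Y₂ ω) n = h}) (o : Option ℕ) :
    MeasurableSet {ω | P.transcript (Y₁ ω) (Y₂ ω) n = h ∧ P.message (Y₁ ω) (Y₂ ω) n = o} := by
  convert hh.inter (P.measurableSet_next_eq hY₁ hY₂ h o) using 1
  ext ω
  simp only [Set.mem_ofPred_eq, Set.mem_inter_iff, message]
  constructor <;> rintro ⟨rfl, h2⟩ <;> exact ⟨rfl, h2⟩

theorem measurableSet_transcript_eq (hY₁ : Measurable Y₁) (hY₂ : Measurable Y₂) (n : ℕ)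
    (h : List ℕ) : MeasurableSet {ω | P.transcript (Y₁ ω) (Y₂ ω) n = h} := by
  induction n generalizing h with
  | zero => exact MeasurableSet.const ([] = h)
  | succ n ih =>
    simp_rw [P.transcript_succ_eq_iff]
    exact P.measurableSet_transcript_message hY₁ hY₂ (ih _) _

theorem measurableSet_message_eq (hY₁ : Measurable Y₁) (hY₂ : Measurable Y₂) (n : ℕ)
    (o : Option ℕ) : MeasurableSet {ω | P.message (Y₁ ω) (Y₂ ω) n = o} := by
  have : {ω | P.message (Y₁ ω) (Y₂ ω) n = o}
      = ⋃ h, {ω | P.transcript (Y₁ ω) (Y₂ ω) n = h ∧ P.message (Y₁ ω) (Y₂ ω) n = o} := by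
    ext ω
    simp
  rw [this]
  exact MeasurableSet.iUnion fun h =>
    P.measurableSet_transcript_message hY₁ hY₂ (P.measurableSet_transcript_eq hY₁ hY₂ n h) o

end Measurable

end Protocol

/-! ### The rectangle property -/

section Rectangle

variable {Ω α β : Type*} [MeasurableSpace Ω] [MeasurableSpace α] [MeasurableSpace β]
  {μ : Measure Ω} {Y₁ : Ω → α} {Y₂ : Ω → β}

/-- If functions of two independent observations agree on a rectangle, they are constant there. -/
theorem exists_const_on_rect (hind : IndepFun Y₁ Y₂ μ)
    {A : Set α} {B : Set β} (hA : MeasurableSet A) (hB : MeasurableSet B) {f : α → Bool}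
    {g : β → Bool} (hf : Measurable f) (hg : Measurable g)
    (hfg : ∀ᵐ ω ∂μ, Y₁ ω ∈ A → Y₂ ω ∈ B → f (Y₁ ω) = g (Y₂ ω)) :
    ∃ b, ∀ᵐ ω ∂μ, Y₁ ω ∈ A → Y₂ ω ∈ B → f (Y₁ ω) = b ∧ g (Y₂ ω) = b := by
  have hA' : MeasurableSet (A ∩ f ⁻¹' {true}) := hA.inter (hf (measurableSet_singleton _))
  have hB' : MeasurableSet (B ∩ g ⁻¹' {false}) := hB.inter (hg (measurableSet_singleton _))
  -- Disagreement within the rectangle is null. By independence its probability factors, so one of f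
  -- = true, g = false is null on its own side.
  have h0 : μ (Y₁ ⁻¹' (A ∩ f ⁻¹' {true}) ∩ Y₂ ⁻¹' (B ∩ g ⁻¹' {false})) = 0 := by
    refine measure_mono_null (fun ω hω => ?_) hfg
    rintro hc
    have h1 : f (Y₁ ω) = true := hω.1.2
    have h2 : g (Y₂ ω) = false := hω.2.2
    have := hc hω.1.1 hω.2.1
    rw [h1, h2] at this
    exact Bool.noConfusion this
  rw [hind.measure_inter_preimage_eq_mul _ _ hA' hB', mul_eq_zero] at h0
  rcases h0 with h0 | h0
  · refine ⟨false, ?_⟩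
    filter_upwards [hfg, measure_eq_zero_iff_ae_notMem.1 h0] with ω h1 h2 hωA hωB
    have : f (Y₁ ω) = false := by
      rw [← Bool.not_eq_true]
      exact fun h => h2 ⟨hωA, h⟩
    exact ⟨this, (h1 hωA hωB).symm.trans this⟩
  · refine ⟨true, ?_⟩
    filter_upwards [hfg, measure_eq_zero_iff_ae_notMem.1 h0] with ω h1 h2 hωA hωB
    have : g (Y₂ ω) = true := by
      rw [← Bool.not_eq_false]
      exact fun h => h2 ⟨hωB, h⟩
    exact ⟨(h1 hωA hωB).trans this, this⟩

/-- Almost surely, the events `H = h` are the preimages of the rectangles `A h × B h`. -/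
structure IsRectangular {ι : Type*} (μ : Measure Ω) (Y₁ : Ω → α) (Y₂ : Ω → β) (H : Ω → ι)
    (A : ι → Set α) (B : ι → Set β) : Prop where
  measurableSet_left : ∀ h, MeasurableSet (A h)
  measurableSet_right : ∀ h, MeasurableSet (B h)
  ae_iff : ∀ᵐ ω ∂μ, ∀ h, H ω = h ↔ Y₁ ω ∈ A h ∧ Y₂ ω ∈ B h

theorem IsRectangular.symm {ι : Type*} {H : Ω → ι} {A : ι → Set α} {B : ι → Set β}
    (h : IsRectangular μ Y₁ Y₂ H A B) : IsRectangular μ Y₂ Y₁ H B A :=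
  ⟨h.2, h.1, by filter_upwards [h.3] with ω hω i using (hω i).trans and_comm⟩

/-- A message determined by the sender's observation is conditionally independent of the
receiver's observation. -/
theorem IsRectangular.condIndepGiven {ι κ : Type*} {H : Ω → ι} {M : Ω → κ} {A : ι → Set α}
    {B : ι → Set β} {A' : ι × κ → Set α} {B' : ι × κ → Set β}
    (hind : IndepFun Y₁ Y₂ μ) (h : IsRectangular μ Y₁ Y₂ H A B)
    (h' : IsRectangular μ Y₁ Y₂ (fun ω => (H ω, M ω)) A' B') (hB : ∀ i o, B' (i, o) = B i) :
    CondIndepGiven μ H M Y₂ := by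
  intro i o D hD
  -- All four events are rectangles with left side A or A' and right side B or B ∩ D. Both sides of
  -- the identity are thus products of the same four factors.
  have key : ∀ {E : Set α} {F : Set β} {s : Set Ω}, MeasurableSet E → MeasurableSet F →
      s =ᵐ[μ] (Y₁ ⁻¹' E ∩ Y₂ ⁻¹' F : Set Ω) → μ.real s = μ.real (Y₁ ⁻¹' E) * μ.real (Y₂ ⁻¹' F) := by
    intro E F s hE hF hs
    rw [Measure.real, measure_congr hs, hind.measure_inter_preimage_eq_mul _ _ hE hF,
      ENNReal.toReal_mul]
    rfl
  have e₁ : μ.real (H ⁻¹' {i} ∩ M ⁻¹' {o} ∩ Y₂ ⁻¹' D)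
      = μ.real (Y₁ ⁻¹' A' (i, o)) * μ.real (Y₂ ⁻¹' (B i ∩ D)) := by
    refine key (h'.1 (i, o)) ((h.2 i).inter hD) ?_
    filter_upwards [h'.3] with ω h2
    have h2 := h2 (i, o)
    rw [hB, Prod.mk.injEq] at h2
    exact propext ((and_congr_left' h2).trans and_assoc)
  have e₂ : μ.real (H ⁻¹' {i}) = μ.real (Y₁ ⁻¹' A i) * μ.real (Y₂ ⁻¹' B i) := by
    refine key (h.1 i) (h.2 i) ?_
    filter_upwards [h.3] with ω h1
    exact propext (h1 i)
  have e₃ : μ.real (H ⁻¹' {i} ∩ M ⁻¹' {o})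
      = μ.real (Y₁ ⁻¹' A' (i, o)) * μ.real (Y₂ ⁻¹' B i) := by
    refine key (h'.1 (i, o)) (h.2 i) ?_
    filter_upwards [h'.3] with ω h2
    have h2 := h2 (i, o)
    rw [hB, Prod.mk.injEq] at h2
    exact propext h2
  have e₄ : μ.real (H ⁻¹' {i} ∩ Y₂ ⁻¹' D)
      = μ.real (Y₁ ⁻¹' A i) * μ.real (Y₂ ⁻¹' (B i ∩ D)) := by
    refine key (h.1 i) ((h.2 i).inter hD) ?_
    filter_upwards [h.3] with ω h1
    exact propext ((and_congr_left' (h1 i)).trans and_assoc)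
  rw [e₁, e₂, e₃, e₄]
  ring

end Rectangle

namespace Protocol

variable {Ω α β : Type*} [MeasurableSpace Ω] [MeasurableSpace α] [MeasurableSpace β]
  (P : Protocol α β) {μ : Measure Ω} {Y₁ : Ω → α} {Y₂ : Ω → β}

/-- Almost surely, the nodes always agree on whether to stop. -/
def StopAgree (μ : Measure Ω) (Y₁ : Ω → α) (Y₂ : Ω → β) : Prop :=
  ∀ᵐ ω ∂μ, ∀ n, P.stop₁ (P.transcript (Y₁ ω) (Y₂ ω) n) (Y₁ ω)
    = P.stop₂ (P.transcript (Y₁ ω) (Y₂ ω) n) (Y₂ ω)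

/-- On each rectangle of transcripts, the decision to stop is almost surely constant. -/
theorem exists_stop_const (hind : IndepFun Y₁ Y₂ μ) (hs : P.StopAgree μ Y₁ Y₂) {n : ℕ}
    {A : List ℕ → Set α} {B : List ℕ → Set β}
    (hr : IsRectangular μ Y₁ Y₂ (fun ω => P.transcript (Y₁ ω) (Y₂ ω) n) A B) :
    ∃ b : List ℕ → Bool, ∀ᵐ ω ∂μ, ∀ h, P.transcript (Y₁ ω) (Y₂ ω) n = h →
      P.stop₁ h (Y₁ ω) = b h ∧ P.stop₂ h (Y₂ ω) = b h := by
  have key : ∀ h, ∃ b, ∀ᵐ ω ∂μ, Y₁ ω ∈ A h → Y₂ ω ∈ B h →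
      P.stop₁ h (Y₁ ω) = b ∧ P.stop₂ h (Y₂ ω) = b := by
    intro h
    refine exists_const_on_rect hind (hr.1 h) (hr.2 h) (P.measurable_stop₁ h)
      (P.measurable_stop₂ h) ?_
    filter_upwards [hs, hr.3] with ω h1 h2 hA hB
    have := h1 n
    rwa [(h2 h).2 ⟨hA, hB⟩] at this
  choose b hb using key
  refine ⟨b, ?_⟩
  filter_upwards [hr.3, ae_all_iff.2 hb] with ω h1 h2 h hh
  exact h2 h ((h1 h).1 hh).1 ((h1 h).1 hh).2

/-- The values of the sender's observation for which `o` is sent after `h`, where `b` tells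
whether the nodes stop. -/
def sentSet {γ : Type*} (send : List ℕ → γ → ℕ) (b : Bool) (h : List ℕ) : Option ℕ → Set γ
  | none => if b then Set.univ else ∅
  | some m => if b then ∅ else send h ⁻¹' {m}

theorem measurableSet_sentSet {γ : Type*} [MeasurableSpace γ] {send : List ℕ → γ → ℕ}
    (hsend : ∀ h, Measurable (send h)) (b : Bool) (h : List ℕ) (o : Option ℕ) :
    MeasurableSet (sentSet send b h o) := by
  cases o <;> cases b <;> simp only [sentSet, if_true, if_false, Bool.false_eq_true]
  · exact MeasurableSet.empty
  · exact MeasurableSet.univ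
  · exact hsend h (measurableSet_singleton _)
  · exact MeasurableSet.empty

theorem mem_sentSet_iff {γ : Type*} {send : List ℕ → γ → ℕ} {b : Bool} {h : List ℕ} {o : Option ℕ}
    {z : γ} : z ∈ sentSet send b h o ↔ (if b = true then none else some (send h z)) = o := by
  cases o <;> cases b <;> simp [sentSet]

/-- If the transcript of `n` steps is rectangular, so is that with the next message, and the side
of the receiver does not depend on that message. -/
theorem exists_isRectangular_message (hind : IndepFun Y₁ Y₂ μ) (hs : P.StopAgree μ Y₁ Y₂) {n : ℕ}
    {A : List ℕ → Set α} {B : List ℕ → Set β}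
    (hr : IsRectangular μ Y₁ Y₂ (fun ω => P.transcript (Y₁ ω) (Y₂ ω) n) A B) :
    ∃ A' B', IsRectangular μ Y₁ Y₂
        (fun ω => (P.transcript (Y₁ ω) (Y₂ ω) n, P.message (Y₁ ω) (Y₂ ω) n)) A' B' ∧
      (Even n → ∀ h o, B' (h, o) = B h) ∧ (¬ Even n → ∀ h o, A' (h, o) = A h) := by
  obtain ⟨b, hb⟩ := P.exists_stop_const hind hs hr
  -- The stopping decision involves both observations, but almost surely it is a function b of the
  -- transcript, so what is sent depends only on the transcript and the sender's observation.
  have hmsg : ∀ᵐ ω ∂μ, P.message (Y₁ ω) (Y₂ ω) n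
      = if b (P.transcript (Y₁ ω) (Y₂ ω) n) = true then none
        else if Even n then some (P.send₁ (P.transcript (Y₁ ω) (Y₂ ω) n) (Y₁ ω))
        else some (P.send₂ (P.transcript (Y₁ ω) (Y₂ ω) n) (Y₂ ω)) := by
    filter_upwards [hb] with ω hω
    obtain ⟨h1, h2⟩ := hω _ rfl
    by_cases hbt : b (P.transcript (Y₁ ω) (Y₂ ω) n) = true
    · rw [if_pos hbt, message_eq_none_iff, h1, h2]
      exact ⟨hbt, hbt⟩
    · have hne : ¬ P.message (Y₁ ω) (Y₂ ω) n = none := by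
        rw [message_eq_none_iff, h1]
        exact fun h => hbt h.1
      have hlen := (P.message_eq_none_or_length _ _ _).resolve_left hne
      rw [if_neg hbt, message, next, if_neg (by rw [h1]; exact fun h => hbt h.1), hlen]
  by_cases hn : Even n
  · refine ⟨fun q => A q.1 ∩ sentSet P.send₁ (b q.1) q.1 q.2, fun q => B q.1,
      ⟨fun q => (hr.1 _).inter (measurableSet_sentSet P.measurable_send₁ _ _ _), fun q => hr.2 _,
        ?_⟩, fun _ _ _ => rfl, fun h => absurd hn h⟩
    filter_upwards [hmsg, hr.3] with ω h1 h2 q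
    rw [Prod.ext_iff, Set.mem_inter_iff, and_right_comm, ← h2 q.1, mem_sentSet_iff]
    refine and_congr_right fun hq => ?_
    rw [h1, if_pos hn]
    change P.transcript (Y₁ ω) (Y₂ ω) n = q.1 at hq
    rw [hq]
  · refine ⟨fun q => A q.1, fun q => B q.1 ∩ sentSet P.send₂ (b q.1) q.1 q.2,
      ⟨fun q => hr.1 _, fun q => (hr.2 _).inter (measurableSet_sentSet P.measurable_send₂ _ _ _),
        ?_⟩, fun h => absurd h hn, fun _ _ _ => rfl⟩
    filter_upwards [hmsg, hr.3] with ω h1 h2 q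
    rw [Prod.ext_iff, Set.mem_inter_iff, ← and_assoc, ← h2 q.1, mem_sentSet_iff]
    refine and_congr_right fun hq => ?_
    rw [h1, if_neg hn]
    change P.transcript (Y₁ ω) (Y₂ ω) n = q.1 at hq
    rw [hq]

theorem exists_isRectangular_transcript (hind : IndepFun Y₁ Y₂ μ) (hs : P.StopAgree μ Y₁ Y₂)
    (n : ℕ) : ∃ A B, IsRectangular μ Y₁ Y₂ (fun ω => P.transcript (Y₁ ω) (Y₂ ω) n) A B := by
  induction n with
  | zero =>
    refine ⟨fun h => {_x | [] = h}, fun _ => Set.univ, fun h => MeasurableSet.const ([] = h),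
      fun _ => MeasurableSet.univ, Filter.Eventually.of_forall fun ω h => ?_⟩
    exact ⟨fun hh => ⟨hh, trivial⟩, fun hh => hh.1⟩
  | succ n ih =>
    obtain ⟨A, B, hr⟩ := ih
    obtain ⟨A', B', hr', -⟩ := P.exists_isRectangular_message hind hs hr
    refine ⟨fun h => A' (splitTranscript n h), fun h => B' (splitTranscript n h),
      fun h => hr'.1 _, fun h => hr'.2 _, ?_⟩
    filter_upwards [hr'.3] with ω hω h
    rw [← hω, P.transcript_succ_eq_iff, Prod.ext_iff]

variable [IsProbabilityMeasure μ]

/-- The new transcript is an injective relabelling of the old one paired with the message, so the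
chain rule applies. Odd steps follow by exchanging the nodes. -/
theorem entropyOf_transcript_succ (hY₁ : Measurable Y₁) (hY₂ : Measurable Y₂)
    (hind : IndepFun Y₁ Y₂ μ) (hs : P.StopAgree μ Y₁ Y₂) (n : ℕ) :
    entropyOf μ (fun ω => P.transcript (Y₁ ω) (Y₂ ω) (n + 1))
      = entropyOf μ (fun ω => P.transcript (Y₁ ω) (Y₂ ω) n)
        + condEntropy μ (fun ω => P.message (Y₁ ω) (Y₂ ω) n) (P.receiverInfo Y₁ Y₂ n) := by
  obtain ⟨A, B, hr⟩ := P.exists_isRectangular_transcript hind hs n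
  obtain ⟨A', B', hr', hB, hA⟩ := P.exists_isRectangular_message hind hs hr
  have hH := P.measurableSet_transcript_eq hY₁ hY₂ n
  have hM := P.measurableSet_message_eq hY₁ hY₂ n
  have h1 : entropyOf μ (fun ω => P.transcript (Y₁ ω) (Y₂ ω) (n + 1))
      = entropyOf μ (fun ω => (P.transcript (Y₁ ω) (Y₂ ω) n, P.message (Y₁ ω) (Y₂ ω) n)) := by
    rw [← entropyOf_comp (I := fun ω => P.transcript (Y₁ ω) (Y₂ ω) (n + 1))
      (φ := splitTranscript n)]
    · simp_rw [P.splitTranscript_transcript]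
    · intro ω ω' h
      rw [← splitTranscript_toList_append n (P.transcript (Y₁ ω) (Y₂ ω) (n + 1)), h,
        splitTranscript_toList_append]
  rw [h1]
  by_cases hn : Even n
  · rw [receiverInfo, if_pos hn]
    exact entropyOf_prodMk hH hM hY₂ (hr.condIndepGiven hind hr' (hB hn))
  · rw [receiverInfo, if_neg hn]
    exact entropyOf_prodMk hH hM hY₁ (hr.symm.condIndepGiven hind.symm hr'.symm (hA hn))

/-- The sum rate is the limit of the entropies of the transcripts. -/
theorem sumRate_eq_iSup_entropyOf (hY₁ : Measurable Y₁) (hY₂ : Measurable Y₂)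
    (hind : IndepFun Y₁ Y₂ μ) (hs : P.StopAgree μ Y₁ Y₂) :
    P.sumRate μ Y₁ Y₂ = ⨆ n, entropyOf μ (fun ω => P.transcript (Y₁ ω) (Y₂ ω) n) := by
  rw [sumRate, ENNReal.tsum_eq_iSup_nat]
  refine iSup_congr fun n => ?_
  induction n with
  | zero =>
    rw [Finset.sum_range_zero, entropyOf, eq_comm, ENNReal.tsum_eq_zero]
    intro h
    by_cases hh : [] = h
    · have : (fun ω => P.transcript (Y₁ ω) (Y₂ ω) 0) ⁻¹' {h} = Set.univ :=
        Set.eq_univ_of_forall fun ω => hh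
      rw [this, probReal_univ, bitsOf_one]
    · have : (fun ω => P.transcript (Y₁ ω) (Y₂ ω) 0) ⁻¹' {h} = ∅ :=
        Set.eq_empty_of_forall_notMem fun ω hω => hh hω
      rw [this, measureReal_empty, bitsOf_zero]
  | succ n ih =>
    rw [Finset.sum_range_succ, ih, P.entropyOf_transcript_succ hY₁ hY₂ hind hs n]
    rfl

end Protocol

/-! ### The lower bound for protocols -/

section LowerBound

variable {Ω α β : Type*} [MeasurableSpace Ω] [MeasurableSpace α] [MeasurableSpace β]
  {μ : Measure Ω} [IsProbabilityMeasure μ] {Y₁ : Ω → α} {Y₂ : Ω → β} {f : α → ℝ} {g : β → ℝ}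

/-- Rectangles live in the space of full observations, private randomness included. Their image in
the square of the numbers is still a product, of the side laws to which `cell_bound` applies. -/
theorem map_restrict_prod_of_indepFun (hY₁ : Measurable Y₁) (hY₂ : Measurable Y₂)
    (hind : IndepFun Y₁ Y₂ μ) (hf : Measurable f) (hg : Measurable g) {A : Set α} {B : Set β}
    (hA : MeasurableSet A) (hB : MeasurableSet B) :
    ((μ.restrict (Y₁ ⁻¹' A)).map (fun ω => f (Y₁ ω))).prod
        ((μ.restrict (Y₂ ⁻¹' B)).map (fun ω => g (Y₂ ω)))
      = (μ.restrict (Y₁ ⁻¹' A ∩ Y₂ ⁻¹' B)).map (fun ω => (f (Y₁ ω), g (Y₂ ω))) := by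
  have hfY : Measurable fun ω => f (Y₁ ω) := hf.comp hY₁
  have hgY : Measurable fun ω => g (Y₂ ω) := hg.comp hY₂
  refine Measure.prod_eq fun s t hs ht => ?_
  rw [Measure.map_apply (hfY.prodMk hgY) (hs.prod ht), Measure.map_apply hfY hs,
    Measure.map_apply hgY ht, Measure.restrict_apply ((hfY.prodMk hgY) (hs.prod ht)),
    Measure.restrict_apply (hfY hs), Measure.restrict_apply (hgY ht)]
  have := hind.measure_inter_preimage_eq_mul _ _ ((hf hs).inter hA) ((hg ht).inter hB)
  rw [Set.preimage_inter, Set.preimage_inter] at this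
  refine Eq.trans (congrArg μ ?_) this
  ext ω
  simp only [Set.mem_inter_iff, Set.mem_preimage, Set.mem_prod]
  tauto

/-- The cell inequality for a set of outcomes that is, up to a null set, a zero-error rectangle. -/
theorem setLIntegral_cellWeight_le (hY₁ : Measurable Y₁) (hY₂ : Measurable Y₂)
    (hind : IndepFun Y₁ Y₂ μ) (hf : Measurable f) (hg : Measurable g)
    (hU₁ : μ.map (fun ω => f (Y₁ ω)) ≤ volume.restrict (Set.Icc 0 1))
    (hU₂ : μ.map (fun ω => g (Y₂ ω)) ≤ volume.restrict (Set.Icc 0 1))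
    {A : Set α} {B : Set β} (hA : MeasurableSet A) (hB : MeasurableSet B) {s : Set Ω}
    (hs : s =ᵐ[μ] (Y₁ ⁻¹' A ∩ Y₂ ⁻¹' B : Set Ω))
    (h0 : (∀ᵐ ω ∂μ, ω ∈ s → g (Y₂ ω) ≤ f (Y₁ ω)) ∨ ∀ᵐ ω ∂μ, ω ∈ s → f (Y₁ ω) < g (Y₂ ω)) :
    ∫⁻ ω in s, cellWeight (f (Y₁ ω), g (Y₂ ω)) ∂μ
      ≤ ENNReal.ofReal (Real.log 2) * bitsOf (μ.real s) + 3 * μ s := by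
  have hfY : Measurable fun ω => f (Y₁ ω) := hf.comp hY₁
  have hgY : Measurable fun ω => g (Y₂ ω) := hg.comp hY₂
  have hprod := map_restrict_prod_of_indepFun hY₁ hY₂ hind hf hg hA hB
  have hnull : ∀ {t : Set (ℝ × ℝ)}, MeasurableSet t →
      (∀ᵐ ω ∂μ, ω ∈ s → (f (Y₁ ω), g (Y₂ ω)) ∉ t) →
      (μ.restrict (Y₁ ⁻¹' A ∩ Y₂ ⁻¹' B)).map (fun ω => (f (Y₁ ω), g (Y₂ ω))) t = 0 := by
    intro t ht hae
    rw [Measure.map_apply (hfY.prodMk hgY) ht, Measure.restrict_apply ((hfY.prodMk hgY) ht)]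
    have hnot : ∀ᵐ ω ∂μ,
        ω ∉ (fun ω => (f (Y₁ ω), g (Y₂ ω))) ⁻¹' t ∩ (Y₁ ⁻¹' A ∩ Y₂ ⁻¹' B) := by
      filter_upwards [hae, hs.mem_iff] with ω h1 h2 hω using h1 (h2.2 hω.2) hω.1
    exact measure_eq_zero_iff_ae_notMem.2 hnot
  have hc := cell_bound (ρ₁ := (μ.restrict (Y₁ ⁻¹' A)).map (fun ω => f (Y₁ ω)))
    (ρ₂ := (μ.restrict (Y₂ ⁻¹' B)).map (fun ω => g (Y₂ ω)))
    ((Measure.map_mono Measure.restrict_le_self hfY).trans hU₁)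
    ((Measure.map_mono Measure.restrict_le_self hgY).trans hU₂) ?_
  · have hmass : ((μ.restrict (Y₁ ⁻¹' A)).map (fun ω => f (Y₁ ω))).real Set.univ
        * ((μ.restrict (Y₂ ⁻¹' B)).map (fun ω => g (Y₂ ω))).real Set.univ = μ.real s := by
      rw [Measure.real, Measure.real, ← ENNReal.toReal_mul, ← Measure.prod_prod, hprod,
        Set.univ_prod_univ, Measure.map_apply (hfY.prodMk hgY) MeasurableSet.univ,
        Set.preimage_univ, Measure.restrict_apply_univ, Measure.real, measure_congr hs]
    rw [hmass, hprod, lintegral_map measurable_cellWeight (hfY.prodMk hgY),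
      ofReal_measureReal (measure_ne_top _ _)] at hc
    rw [setLIntegral_congr hs]
    exact hc
  · rw [hprod]
    refine h0.imp (fun h => hnull (measurableSet_lt measurable_fst measurable_snd) ?_)
      (fun h => hnull (measurableSet_le measurable_snd measurable_fst) ?_)
    · filter_upwards [h] with ω hω hωs using not_lt.2 (hω hωs)
    · filter_upwards [h] with ω hω hωs using not_le.2 (hω hωs)

/-- Each zero-error protocol for comparing two independent uniform numbers, which are functions of
the observations, has a sum rate of at least four bits. -/
theorem Protocol.four_le_sumRate (P : Protocol α β) (hY₁ : Measurable Y₁) (hY₂ : Measurable Y₂)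
    (hind : IndepFun Y₁ Y₂ μ) (hf : Measurable f) (hg : Measurable g)
    (hU₁ : μ.map (fun ω => f (Y₁ ω)) = volume.restrict (Set.Ioo 0 1))
    (hU₂ : μ.map (fun ω => g (Y₂ ω)) = volume.restrict (Set.Ioo 0 1))
    (hP : P.ZeroError μ Y₁ Y₂ (fun ω => g (Y₂ ω) ≤ f (Y₁ ω))) : 4 ≤ P.sumRate μ Y₁ Y₂ := by
  have hs : P.StopAgree μ Y₁ Y₂ := hP.mono fun ω h => h.1
  have hfY : Measurable fun ω => f (Y₁ ω) := hf.comp hY₁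
  have hgY : Measurable fun ω => g (Y₂ ω) := hg.comp hY₂
  set stopped : ℕ → Set Ω := fun n => {ω | P.message (Y₁ ω) (Y₂ ω) n = none}
  have hstop_mono : Monotone stopped := fun n m hnm ω hω => (P.transcript_eq_of_none hω hnm).1
  have hout : ∀ᵐ ω ∂μ, ∀ n, ω ∈ stopped n →
      (P.out₁ (P.transcript (Y₁ ω) (Y₂ ω) n) (Y₁ ω) = true ↔ g (Y₂ ω) ≤ f (Y₁ ω)) ∧
      (P.out₂ (P.transcript (Y₁ ω) (Y₂ ω) n) (Y₂ ω) = true ↔ g (Y₂ ω) ≤ f (Y₁ ω)) := by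
    filter_upwards [hP] with ω ⟨h1, m, h2, h3⟩ n hn
    have hm : P.message (Y₁ ω) (Y₂ ω) m = none := P.message_eq_none_iff.2 ⟨h2, h1 m ▸ h2⟩
    have e : P.transcript (Y₁ ω) (Y₂ ω) n = P.transcript (Y₁ ω) (Y₂ ω) m :=
      (P.transcript_eq_of_none hn (le_max_left n m)).2.symm.trans
        (P.transcript_eq_of_none hm (le_max_right n m)).2
    rw [e]
    exact h3
  have hunion : (⋃ n, stopped n) =ᵐ[μ] (Set.univ : Set Ω) := by
    rw [Filter.eventuallyEq_univ]
    filter_upwards [hP] with ω ⟨h1, m, h2, _⟩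
    exact Set.mem_iUnion.2 ⟨m, P.message_eq_none_iff.2 ⟨h2, h1 m ▸ h2⟩⟩
  have hIcc : volume.restrict (Set.Ioo (0 : ℝ) 1) ≤ volume.restrict (Set.Icc 0 1) :=
    Measure.restrict_mono Set.Ioo_subset_Icc_self le_rfl
  -- At each finite step only the stopped outcomes are weighed, against the entropy of the whole
  -- transcript. Final transcripts are never needed, and unfinished ones only increase the
  -- right-hand side.
  have hbound : ∀ n, ∫⁻ ω in stopped n, cellWeight (f (Y₁ ω), g (Y₂ ω)) ∂μ
      ≤ ENNReal.ofReal (Real.log 2) * P.sumRate μ Y₁ Y₂ + 3 := by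
    intro n
    obtain ⟨A, B, hr⟩ := P.exists_isRectangular_transcript hind hs n
    obtain ⟨b, hb⟩ := P.exists_stop_const hind hs hr
    set C : List ℕ → Set Ω := fun h => {ω | P.transcript (Y₁ ω) (Y₂ ω) n = h} with hC
    have hCm : ∀ h, MeasurableSet (C h) := P.measurableSet_transcript_eq hY₁ hY₂ n
    have hCr : ∀ h, C h =ᵐ[μ] (Y₁ ⁻¹' A h ∩ Y₂ ⁻¹' B h : Set Ω) := by
      intro h
      filter_upwards [hr.3] with ω hω using propext (hω h)
    have hcell : ∀ h, ∫⁻ ω in stopped n ∩ C h, cellWeight (f (Y₁ ω), g (Y₂ ω)) ∂μ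
        ≤ ENNReal.ofReal (Real.log 2) * bitsOf (μ.real (C h)) + 3 * μ (C h) := by
      intro h
      by_cases hbh : b h = true
      · refine (lintegral_mono_set Set.inter_subset_right).trans ?_
        have hleaf : ∀ᵐ ω ∂μ, ω ∈ C h → ω ∈ stopped n := by
          filter_upwards [hb] with ω hω hωC
          have hωC' : P.transcript (Y₁ ω) (Y₂ ω) n = h := hωC
          have := hω h hωC
          rw [hbh] at this
          refine P.message_eq_none_iff.2 ?_
          rw [hωC']
          exact this
        -- Both outputs equal the truth, hence each other, hence a constant on the rectangle: the
        -- cell is zero-error.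
        obtain ⟨c, hc⟩ := exists_const_on_rect hind (hr.1 h) (hr.2 h) (P.measurable_out₁ h)
          (P.measurable_out₂ h) (by
            filter_upwards [hleaf, hout, hr.3] with ω h1 h2 h3 hωA hωB
            have hωC := (h3 h).2 ⟨hωA, hωB⟩
            have := h2 n (h1 hωC)
            rw [hωC] at this
            exact Bool.eq_iff_iff.2 (this.1.trans this.2.symm))
        refine setLIntegral_cellWeight_le hY₁ hY₂ hind hf hg (hU₁.trans_le hIcc)
          (hU₂.trans_le hIcc) (hr.1 h) (hr.2 h) (hCr h) ?_
        have hF : ∀ᵐ ω ∂μ, ω ∈ C h → (c = true ↔ g (Y₂ ω) ≤ f (Y₁ ω)) := by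
          filter_upwards [hleaf, hout, hr.3, hc] with ω h1 h2 h3 h4 hωC
          have h5 := h2 n (h1 hωC)
          rw [show P.transcript (Y₁ ω) (Y₂ ω) n = h from hωC] at h5
          have h6 := (h3 h).1 hωC
          rw [← (h4 h6.1 h6.2).1]
          exact h5.1
        rcases Bool.eq_false_or_eq_true c with rfl | rfl
        · left
          filter_upwards [hF] with ω hω hωC using (hω hωC).1 rfl
        · right
          filter_upwards [hF] with ω hω hωC
          exact not_le.1 fun hle => Bool.noConfusion ((hω hωC).2 hle)
      · have : μ (stopped n ∩ C h) = 0 := by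
          refine measure_eq_zero_iff_ae_notMem.2 ?_
          filter_upwards [hb] with ω hc hω
          have h1 := (P.message_eq_none_iff.1 hω.1).1
          rw [show P.transcript (Y₁ ω) (Y₂ ω) n = h from hω.2, (hc h hω.2).1] at h1
          exact hbh h1
        rw [setLIntegral_measure_zero _ _ this]
        exact zero_le
    have hsum : ∑' h, μ (C h) = 1 := by
      rw [← measure_iUnion (fun h h' hne => ?_) hCm]
      · have : ⋃ h, C h = Set.univ := Set.eq_univ_of_forall fun ω => Set.mem_iUnion.2 ⟨_, rfl⟩
        rw [this, measure_univ]
      · rw [Function.onFun, Set.disjoint_left]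
        intro ω h1 h2
        exact hne (Eq.trans (Eq.symm h1) h2)
    calc ∫⁻ ω in stopped n, cellWeight (f (Y₁ ω), g (Y₂ ω)) ∂μ
        = ∫⁻ ω in ⋃ h, stopped n ∩ C h, cellWeight (f (Y₁ ω), g (Y₂ ω)) ∂μ := by
          congr 2
          ext ω
          simp [hC]
      _ ≤ ∑' h, ∫⁻ ω in stopped n ∩ C h, cellWeight (f (Y₁ ω), g (Y₂ ω)) ∂μ :=
          lintegral_iUnion_le _ _
      _ ≤ ∑' h, (ENNReal.ofReal (Real.log 2) * bitsOf (μ.real (C h)) + 3 * μ (C h)) :=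
          ENNReal.tsum_le_tsum hcell
      _ = ENNReal.ofReal (Real.log 2)
            * entropyOf μ (fun ω => P.transcript (Y₁ ω) (Y₂ ω) n) + 3 := by
          rw [ENNReal.tsum_add, ENNReal.tsum_mul_left, ENNReal.tsum_mul_left, hsum, mul_one]
          rfl
      _ ≤ ENNReal.ofReal (Real.log 2) * P.sumRate μ Y₁ Y₂ + 3 := by
          rw [P.sumRate_eq_iSup_entropyOf hY₁ hY₂ hind hs]
          gcongr
          exact le_iSup (fun n => entropyOf μ (fun ω => P.transcript (Y₁ ω) (Y₂ ω) n)) n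
  refine four_le_of_weight_le ?_
  have htotal : ∫⁻ ω, cellWeight (f (Y₁ ω), g (Y₂ ω)) ∂μ = 3 + ENNReal.ofReal (4 * Real.log 2) := by
    have h := map_restrict_prod_of_indepFun hY₁ hY₂ hind hf hg MeasurableSet.univ MeasurableSet.univ
    simp only [Set.preimage_univ, Set.inter_univ, Measure.restrict_univ] at h
    rw [hU₁, hU₂] at h
    rw [← lintegral_cellWeight_unit, h, lintegral_map measurable_cellWeight (hfY.prodMk hgY)]
  -- The stopped events increase to almost everything, so the bounds pass to the limit.
  rw [← htotal, ← setLIntegral_univ, ← setLIntegral_congr hunion,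
    setLIntegral_iUnion_of_directed _ hstop_mono.directed_le]
  exact iSup_le hbound

end LowerBound

/-! ### The bit-exchange protocol, pointwise -/

section Pointwise

variable {S₁ S₂ : Type*} [MeasurableSpace S₁] [MeasurableSpace S₂]

theorem bitExchange_message_of_not_differ {x : ℝ × S₁} {y : ℝ × S₂} {n : ℕ}
    (h : lastBitsDiffer ((bitExchange S₁ S₂).transcript x y n) = false)
    (hlen : ((bitExchange S₁ S₂).transcript x y n).length = n) :
    (bitExchange S₁ S₂).message x y n
      = if Even n then some (bit x.1 (n / 2)) else some (bit y.1 (n / 2)) := by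
  have h1 : ¬ ((bitExchange S₁ S₂).stop₁ ((bitExchange S₁ S₂).transcript x y n) x = true ∧
      (bitExchange S₁ S₂).stop₂ ((bitExchange S₁ S₂).transcript x y n) y = true) := by
    rintro ⟨h2, -⟩
    exact Bool.noConfusion (h.symm.trans h2)
  rw [Protocol.message, Protocol.next, if_neg h1, hlen]
  change (if Even n then some (bit x.1 (_ / 2)) else some (bit y.1 (_ / 2))) = _
  rw [hlen]

theorem bitExchange_message_eq_none_iff {x : ℝ × S₁} {y : ℝ × S₂} {n : ℕ} :
    (bitExchange S₁ S₂).message x y n = none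
      ↔ lastBitsDiffer ((bitExchange S₁ S₂).transcript x y n) = true :=
  Protocol.message_eq_none_iff _ |>.trans and_self_iff

/-- A round of the protocol in which the nodes have not stopped yet. -/
theorem bitExchange_round {x : ℝ × S₁} {y : ℝ × S₂} {k : ℕ}
    (hlen : ((bitExchange S₁ S₂).transcript x y (2 * k)).length = 2 * k)
    (h : lastBitsDiffer ((bitExchange S₁ S₂).transcript x y (2 * k)) = false) :
    (bitExchange S₁ S₂).transcript x y (2 * k + 2)
      = bit y.1 k :: bit x.1 k :: (bitExchange S₁ S₂).transcript x y (2 * k) := by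
  have h1 := bitExchange_message_of_not_differ h hlen
  rw [if_pos (even_two_mul k), Nat.mul_div_cancel_left k two_pos] at h1
  have h2 := Protocol.transcript_succ_of_some _ h1
  -- In mid-round the two latest bits belong to different rounds; the parity test in
  -- `lastBitsDiffer` rejects them.
  have h3 : lastBitsDiffer ((bitExchange S₁ S₂).transcript x y (2 * k + 1)) = false := by
    rw [h2]
    cases ht : (bitExchange S₁ S₂).transcript x y (2 * k) with
    | nil => rfl
    | cons a t =>
      rw [ht, List.length_cons] at hlen
      have : ¬ Even t.length := by
        rw [Nat.not_even_iff_odd]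
        exact ⟨k - 1, by omega⟩
      simp [lastBitsDiffer, this]
  have h4 := bitExchange_message_of_not_differ h3 (by rw [h2, List.length_cons, hlen])
  rw [if_neg (Nat.not_even_iff_odd.2 (odd_two_mul_add_one k)),
    show (2 * k + 1) / 2 = k by omega] at h4
  rw [Protocol.transcript_succ_of_some _ h4, h2]

theorem bitExchange_transcript_of_agree {x : ℝ × S₁} {y : ℝ × S₂} {k : ℕ}
    (h : dyadicFloor k x.1 = dyadicFloor k y.1) :
    ((bitExchange S₁ S₂).transcript x y (2 * k)).length = 2 * k ∧
      lastBitsDiffer ((bitExchange S₁ S₂).transcript x y (2 * k)) = false := by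
  induction k with
  | zero => exact ⟨rfl, rfl⟩
  | succ k ih =>
    obtain ⟨h1, h2⟩ := dyadicFloor_succ_eq_iff.1 h
    obtain ⟨h3, h4⟩ := ih h1
    rw [show 2 * (k + 1) = 2 * k + 2 by ring, bitExchange_round h3 h4]
    simp [lastBitsDiffer, h3, h2]

theorem bitExchange_transcript_of_first_ne {x : ℝ × S₁} {y : ℝ × S₂} {k : ℕ}
    (h : dyadicFloor k x.1 = dyadicFloor k y.1) (hne : bit x.1 k ≠ bit y.1 k) :
    (bitExchange S₁ S₂).transcript x y (2 * k + 2)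
        = bit y.1 k :: bit x.1 k :: (bitExchange S₁ S₂).transcript x y (2 * k) ∧
      ((bitExchange S₁ S₂).transcript x y (2 * k + 2)).length = 2 * k + 2 ∧
      lastBitsDiffer ((bitExchange S₁ S₂).transcript x y (2 * k + 2)) = true := by
  obtain ⟨h3, h4⟩ := bitExchange_transcript_of_agree h
  have h5 := bitExchange_round h3 h4
  refine ⟨h5, ?_, ?_⟩
  · rw [h5, List.length_cons, List.length_cons, h3]
  · rw [h5]
    simp [lastBitsDiffer, h3, hne]

theorem bitExchange_numMessages_of_first_ne {x : ℝ × S₁} {y : ℝ × S₂} {k : ℕ}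
    (h : dyadicFloor k x.1 = dyadicFloor k y.1) (hne : bit x.1 k ≠ bit y.1 k) :
    (bitExchange S₁ S₂).numMessages x y = ((2 * k + 2 : ℕ) : ℝ≥0∞) := by
  obtain ⟨-, h1, h2⟩ := bitExchange_transcript_of_first_ne h hne
  refine le_antisymm (iSup_le fun n => ?_) ?_
  · rw [Nat.cast_le]
    rcases le_total n (2 * k + 2) with hn | hn
    · exact (Protocol.length_transcript_le _ x y n).trans hn
    · rw [(Protocol.transcript_eq_of_none _ (bitExchange_message_eq_none_iff.2 h2) hn).2, h1]
  · refine le_trans ?_ (le_iSup (fun n => (((bitExchange S₁ S₂).transcript x y n).length : ℝ≥0∞))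
      (2 * k + 2))
    rw [h1]

/-- If digit k is the first to differ, the prefixes agree exactly for the lengths 0, ..., k, and
each of them opens a round of two messages. In this form the mean needs only the probabilities of
agreement. -/
theorem bitExchange_numMessages_eq_tsum {x : ℝ × S₁} {y : ℝ × S₂} (hx : x.1 ∈ Set.Ico (0 : ℝ) 1)
    (hy : y.1 ∈ Set.Ico (0 : ℝ) 1) (hxy : x.1 ≠ y.1) :
    (bitExchange S₁ S₂).numMessages x y
      = ∑' k, {z : ℝ × ℝ | dyadicFloor k z.1 = dyadicFloor k z.2}.indicator
          (fun _ => (2 : ℝ≥0∞)) (x.1, y.1) := by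
  obtain ⟨k, h, hne⟩ := exists_first_bit_ne hx hy hxy
  rw [bitExchange_numMessages_of_first_ne h hne, tsum_eq_sum (s := Finset.range (k + 1))]
  · rw [Finset.sum_congr rfl (g := fun _ => (2 : ℝ≥0∞)), Finset.sum_const, Finset.card_range,
      nsmul_eq_mul]
    · push_cast
      ring
    · intro j hj
      refine Set.indicator_of_mem ?_ _
      exact dyadicFloor_eq_of_le (Nat.lt_succ_iff.1 (Finset.mem_range.1 hj)) h
  · intro j hj
    refine Set.indicator_of_notMem (fun hc => hne ?_) _
    rw [Finset.mem_range, not_lt] at hj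
    exact (dyadicFloor_succ_eq_iff.1 (dyadicFloor_eq_of_le hj hc)).2

/-- The transcript determines, and is determined by, the digits that have been sent. -/
theorem bitExchange_transcript_eq_iff {x x' : ℝ × S₁} {y y' : ℝ × S₂} (hx : x.1 < 1)
    (hx' : x'.1 < 1) (hy : y.1 < 1) (hy' : y'.1 < 1) (n : ℕ) :
    (bitExchange S₁ S₂).transcript x' y' n = (bitExchange S₁ S₂).transcript x y n ↔
      dyadicFloor ((((bitExchange S₁ S₂).transcript x y n).length + 1) / 2) x'.1
          = dyadicFloor ((((bitExchange S₁ S₂).transcript x y n).length + 1) / 2) x.1 ∧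
      dyadicFloor (((bitExchange S₁ S₂).transcript x y n).length / 2) y'.1
          = dyadicFloor (((bitExchange S₁ S₂).transcript x y n).length / 2) y.1 := by
  induction n with
  | zero =>
    simp only [Protocol.transcript, List.length_nil]
    norm_num [dyadicFloor_zero, hx, hx', hy, hy']
  | succ n ih =>
    rw [Protocol.transcript_succ_eq_iff, Protocol.splitTranscript_transcript]
    by_cases hd : lastBitsDiffer ((bitExchange S₁ S₂).transcript x y n) = true
    · have hm := bitExchange_message_eq_none_iff.2 hd
      rw [Protocol.transcript_succ_of_none _ hm, ← ih, hm]
      refine and_iff_left_of_imp fun h => ?_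
      rw [bitExchange_message_eq_none_iff, h]
      exact hd
    · have hm : ¬ (bitExchange S₁ S₂).message x y n = none := by
        rwa [bitExchange_message_eq_none_iff]
      have hlen := (Protocol.message_eq_none_or_length _ x y n).resolve_left hm
      rw [Bool.not_eq_true] at hd
      have hm₁ := bitExchange_message_of_not_differ hd hlen
      have hlen' : ((bitExchange S₁ S₂).transcript x y (n + 1)).length = n + 1 := by
        split_ifs at hm₁ with he <;>
          rw [Protocol.transcript_succ_of_some _ hm₁, List.length_cons, hlen]
      rw [hlen']
      rw [hlen] at ih
      have step : ((bitExchange S₁ S₂).transcript x' y' n = (bitExchange S₁ S₂).transcript x y n ∧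
          (bitExchange S₁ S₂).message x' y' n = (bitExchange S₁ S₂).message x y n) ↔
          ((bitExchange S₁ S₂).transcript x' y' n = (bitExchange S₁ S₂).transcript x y n ∧
          if Even n then bit x'.1 (n / 2) = bit x.1 (n / 2)
            else bit y'.1 (n / 2) = bit y.1 (n / 2)) := by
        refine and_congr_right fun h => ?_
        rw [bitExchange_message_of_not_differ (h ▸ hd) (h ▸ hlen), hm₁]
        split_ifs <;> exact Option.some_inj
      rw [step, ih]
      -- Node 1 speaks first, so an even step lengthens the known prefix of x and an odd step that
      -- of y.
      rcases Nat.even_or_odd' n with ⟨j, rfl | rfl⟩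
      · rw [if_pos (even_two_mul j), show (2 * j + 1 + 1) / 2 = j + 1 by omega,
          show (2 * j + 1) / 2 = j by omega, show 2 * j / 2 = j by omega,
          dyadicFloor_succ_eq_iff]
        tauto
      · rw [if_neg (Nat.not_even_iff_odd.2 (odd_two_mul_add_one j)),
          show (2 * j + 1 + 1 + 1) / 2 = j + 1 by omega, show (2 * j + 1 + 1) / 2 = j + 1 by omega,
          show (2 * j + 1) / 2 = j by omega, dyadicFloor_succ_eq_iff (x := y'.1)]
        tauto

end Pointwise

/-! ### The bit-exchange protocol, on average -/

theorem lintegral_comp_of_countable {Ω ι : Type*} [mΩ : MeasurableSpace Ω] {μ : Measure Ω}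
    [Countable ι] {H : Ω → ι} (hH : ∀ h, MeasurableSet (H ⁻¹' {h})) (φ : ι → ℝ≥0∞) :
    ∫⁻ ω, φ (H ω) ∂μ = ∑' h, φ h * μ (H ⁻¹' {h}) := by
  let _ : MeasurableSpace ι := ⊤
  have hHm : Measurable H := measurable_top_of_countable hH
  rw [← lintegral_map (f := φ) (fun _ _ => trivial) hHm, lintegral_countable']
  exact tsum_congr fun h => by rw [Measure.map_apply hHm trivial]

section Average

variable {Ω S₁ S₂ : Type*} [MeasurableSpace Ω] [MeasurableSpace S₁] [MeasurableSpace S₂]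
  {μ : Measure Ω} {Y₁ : Ω → ℝ × S₁} {Y₂ : Ω → ℝ × S₂}

theorem measure_preimage_dyadicIco {X : Ω → ℝ} (hX : Measurable X)
    (hU : μ.map X = volume.restrict (Set.Ioo 0 1)) {m i : ℕ} (hi : i < 2 ^ m) :
    μ (X ⁻¹' dyadicIco m i) = ENNReal.ofReal ((1 / 2) ^ m) := by
  rw [← Measure.map_apply hX (measurableSet_dyadicIco m i), hU, restrict_Ioo_eq_restrict_Ico,
    Measure.restrict_apply (measurableSet_dyadicIco m i),
    Set.inter_eq_left.2 (dyadicIco_subset hi), volume_dyadicIco]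

theorem ae_mem_Ioo {X : Ω → ℝ} (hX : Measurable X)
    (hU : μ.map X = volume.restrict (Set.Ioo 0 1)) : ∀ᵐ ω ∂μ, X ω ∈ Set.Ioo (0 : ℝ) 1 := by
  refine ae_of_ae_map hX.aemeasurable ?_
  rw [hU]
  exact ae_restrict_mem measurableSet_Ioo

theorem measure_dyadicIco_inter (hY₁ : Measurable Y₁) (hY₂ : Measurable Y₂)
    (hind : IndepFun Y₁ Y₂ μ)
    (hU₁ : μ.map (fun ω => (Y₁ ω).1) = volume.restrict (Set.Ioo 0 1))
    (hU₂ : μ.map (fun ω => (Y₂ ω).1) = volume.restrict (Set.Ioo 0 1)) {m i m' i' : ℕ}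
    (hi : i < 2 ^ m) (hi' : i' < 2 ^ m') :
    μ {ω | (Y₁ ω).1 ∈ dyadicIco m i ∧ (Y₂ ω).1 ∈ dyadicIco m' i'}
      = ENNReal.ofReal ((1 / 2) ^ (m + m')) := by
  rw [pow_add, ENNReal.ofReal_mul (by positivity), ← measure_preimage_dyadicIco hY₁.fst hU₁ hi,
    ← measure_preimage_dyadicIco hY₂.fst hU₂ hi']
  exact hind.measure_inter_preimage_eq_mul _ _ (measurable_fst (measurableSet_dyadicIco m i))
    (measurable_fst (measurableSet_dyadicIco m' i'))

theorem ae_fst_ne_fst [IsProbabilityMeasure μ] (hY₁ : Measurable Y₁)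
    (hY₂ : Measurable Y₂) (hind : IndepFun Y₁ Y₂ μ)
    (hU₁ : μ.map (fun ω => (Y₁ ω).1) = volume.restrict (Set.Ioo 0 1))
    (hU₂ : μ.map (fun ω => (Y₂ ω).1) = volume.restrict (Set.Ioo 0 1)) :
    ∀ᵐ ω ∂μ, (Y₁ ω).1 ≠ (Y₂ ω).1 := by
  have hX₁ := hY₁.fst
  have hX₂ := hY₂.fst
  have h := map_restrict_prod_of_indepFun hY₁ hY₂ hind measurable_fst measurable_fst
    MeasurableSet.univ MeasurableSet.univ
  simp only [Set.preimage_univ, Set.inter_univ, Measure.restrict_univ] at h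
  have h0 : μ.map (fun ω => ((Y₁ ω).1, (Y₂ ω).1)) {z | z.1 = z.2} = 0 := by
    rw [← h, hU₁, hU₂, Measure.prod_restrict, ← Measure.volume_eq_prod]
    exact Measure.restrict_le_self.absolutelyContinuous volume_diagonal
  rw [Measure.map_apply (hX₁.prodMk hX₂) (measurableSet_eq_fun measurable_fst measurable_snd)] at h0
  exact measure_eq_zero_iff_ae_notMem.1 h0

/-- The probability that the first `k` digits agree. -/
theorem measure_dyadicFloor_eq (hY₁ : Measurable Y₁) (hY₂ : Measurable Y₂)
    (hind : IndepFun Y₁ Y₂ μ)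
    (hU₁ : μ.map (fun ω => (Y₁ ω).1) = volume.restrict (Set.Ioo 0 1))
    (hU₂ : μ.map (fun ω => (Y₂ ω).1) = volume.restrict (Set.Ioo 0 1)) (k : ℕ) :
    μ {ω | dyadicFloor k (Y₁ ω).1 = dyadicFloor k (Y₂ ω).1} = ENNReal.ofReal ((1 / 2) ^ k) := by
  have hae : {ω | dyadicFloor k (Y₁ ω).1 = dyadicFloor k (Y₂ ω).1} =ᵐ[μ]
      ⋃ j ∈ Finset.range (2 ^ k), {ω | (Y₁ ω).1 ∈ dyadicIco k j ∧ (Y₂ ω).1 ∈ dyadicIco k j} := by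
    filter_upwards [ae_mem_Ioo hY₁.fst hU₁, ae_mem_Ioo hY₂.fst hU₂] with ω h1 h2
    refine propext ?_
    change dyadicFloor k (Y₁ ω).1 = dyadicFloor k (Y₂ ω).1 ↔ ω ∈ ⋃ j ∈ Finset.range (2 ^ k),
      {ω | (Y₁ ω).1 ∈ dyadicIco k j ∧ (Y₂ ω).1 ∈ dyadicIco k j}
    simp only [Set.mem_iUnion, Set.mem_ofPred_eq, mem_dyadicIco, Finset.mem_range]
    constructor
    · intro h
      exact ⟨_, dyadicFloor_lt h1.2, ⟨h1.1.le, rfl⟩, h2.1.le, h.symm⟩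
    · rintro ⟨j, -, ⟨-, h3⟩, -, h4⟩
      exact h3.trans h4.symm
  rw [measure_congr hae, measure_biUnion_finset]
  · rw [Finset.sum_congr rfl fun j hj => measure_dyadicIco_inter hY₁ hY₂ hind hU₁ hU₂
      (Finset.mem_range.1 hj) (Finset.mem_range.1 hj), Finset.sum_const, Finset.card_range,
      nsmul_eq_mul, ← ENNReal.ofReal_natCast, ← ENNReal.ofReal_mul (by positivity), pow_add,
      ← mul_assoc]
    congr 1
    push_cast
    rw [← mul_pow]
    norm_num
  · intro i _ j _ hij
    rw [Function.onFun, Set.disjoint_left]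
    rintro ω ⟨h1, -⟩ ⟨h2, -⟩
    exact hij ((mem_dyadicIco.1 h1).2.symm.trans (mem_dyadicIco.1 h2).2)
  · intro j _
    exact (hY₁.fst (measurableSet_dyadicIco k j)).inter (hY₂.fst (measurableSet_dyadicIco k j))

theorem bitExchange_zeroError [IsProbabilityMeasure μ] (hY₁ : Measurable Y₁)
    (hY₂ : Measurable Y₂) (hind : IndepFun Y₁ Y₂ μ)
    (hU₁ : μ.map (fun ω => (Y₁ ω).1) = volume.restrict (Set.Ioo 0 1))
    (hU₂ : μ.map (fun ω => (Y₂ ω).1) = volume.restrict (Set.Ioo 0 1)) :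
    (bitExchange S₁ S₂).ZeroError μ Y₁ Y₂ (fun ω => (Y₂ ω).1 ≤ (Y₁ ω).1) := by
  filter_upwards [ae_mem_Ioo hY₁.fst hU₁, ae_mem_Ioo hY₂.fst hU₂,
    ae_fst_ne_fst hY₁ hY₂ hind hU₁ hU₂] with ω h1 h2 h3
  refine ⟨fun n => rfl, ?_⟩
  obtain ⟨k, h, hne⟩ := exists_first_bit_ne (Set.Ioo_subset_Ico_self h1)
    (Set.Ioo_subset_Ico_self h2) h3
  obtain ⟨h4, -, h5⟩ := bitExchange_transcript_of_first_ne (x := Y₁ ω) (y := Y₂ ω) h hne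
  have hout : lastBitOne ((bitExchange S₁ S₂).transcript (Y₁ ω) (Y₂ ω) (2 * k + 2)) = true
      ↔ (Y₂ ω).1 ≤ (Y₁ ω).1 := by
    rw [h4]
    simp only [lastBitOne, decide_eq_true_eq]
    rw [bit_eq_one_iff_of_first_ne h hne]
    exact ⟨le_of_lt, fun hle => lt_of_le_of_ne hle h3.symm⟩
  exact ⟨2 * k + 2, h5, hout, hout⟩

theorem lintegral_bitExchange_numMessages [IsProbabilityMeasure μ] (hY₁ : Measurable Y₁)
    (hY₂ : Measurable Y₂)
    (hind : IndepFun Y₁ Y₂ μ)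
    (hU₁ : μ.map (fun ω => (Y₁ ω).1) = volume.restrict (Set.Ioo 0 1))
    (hU₂ : μ.map (fun ω => (Y₂ ω).1) = volume.restrict (Set.Ioo 0 1)) :
    ∫⁻ ω, (bitExchange S₁ S₂).numMessages (Y₁ ω) (Y₂ ω) ∂μ = 4 := by
  have hagree : ∀ k, MeasurableSet {z : ℝ × ℝ | dyadicFloor k z.1 = dyadicFloor k z.2} := fun k =>
    measurableSet_eq_fun ((measurable_dyadicFloor k).comp measurable_fst)
      ((measurable_dyadicFloor k).comp measurable_snd)
  have hX : Measurable fun ω => ((Y₁ ω).1, (Y₂ ω).1) := hY₁.fst.prodMk hY₂.fst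
  calc ∫⁻ ω, (bitExchange S₁ S₂).numMessages (Y₁ ω) (Y₂ ω) ∂μ
      = ∫⁻ ω, ∑' k, {z : ℝ × ℝ | dyadicFloor k z.1 = dyadicFloor k z.2}.indicator
          (fun _ => (2 : ℝ≥0∞)) ((Y₁ ω).1, (Y₂ ω).1) ∂μ := by
        refine lintegral_congr_ae ?_
        filter_upwards [ae_mem_Ioo hY₁.fst hU₁, ae_mem_Ioo hY₂.fst hU₂,
          ae_fst_ne_fst hY₁ hY₂ hind hU₁ hU₂] with ω h1 h2 h3
        exact bitExchange_numMessages_eq_tsum (Set.Ioo_subset_Ico_self h1)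
          (Set.Ioo_subset_Ico_self h2) h3
    _ = ∑' k, 2 * ENNReal.ofReal ((1 / 2) ^ k) := by
        have hm : ∀ k, AEMeasurable (fun ω => {z : ℝ × ℝ | dyadicFloor k z.1
            = dyadicFloor k z.2}.indicator (fun _ => (2 : ℝ≥0∞)) ((Y₁ ω).1, (Y₂ ω).1)) μ := fun k =>
          ((measurable_const.indicator (hagree k)).comp hX).aemeasurable
        rw [lintegral_tsum hm]
        refine tsum_congr fun k => ?_
        rw [← measure_dyadicFloor_eq hY₁ hY₂ hind hU₁ hU₂ k]
        exact lintegral_indicator_const (hX (hagree k)) 2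
    _ = 4 := by
        rw [ENNReal.tsum_mul_left, ← ENNReal.ofReal_tsum_of_nonneg (fun k => by positivity)
          summable_geometric_two, tsum_geometric_two, ENNReal.ofReal_ofNat]
        norm_num

/-- All transcripts of a given length that occur are equally likely. -/
theorem entropyOf_bitExchange_transcript (hY₁ : Measurable Y₁) (hY₂ : Measurable Y₂)
    (hind : IndepFun Y₁ Y₂ μ)
    (hU₁ : μ.map (fun ω => (Y₁ ω).1) = volume.restrict (Set.Ioo 0 1))
    (hU₂ : μ.map (fun ω => (Y₂ ω).1) = volume.restrict (Set.Ioo 0 1)) (n : ℕ) :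
    entropyOf μ (fun ω => (bitExchange S₁ S₂).transcript (Y₁ ω) (Y₂ ω) n)
      = ∫⁻ ω, (((bitExchange S₁ S₂).transcript (Y₁ ω) (Y₂ ω) n).length : ℝ≥0∞) ∂μ := by
  have hI₁ := ae_mem_Ioo hY₁.fst hU₁
  have hI₂ := ae_mem_Ioo hY₂.fst hU₂
  rw [lintegral_comp_of_countable
    ((bitExchange S₁ S₂).measurableSet_transcript_eq hY₁ hY₂ n)
    (fun h => (h.length : ℝ≥0∞)), entropyOf]
  refine tsum_congr fun h => ?_
  by_cases hex : ∃ ω, (Y₁ ω).1 ∈ Set.Ioo (0 : ℝ) 1 ∧ (Y₂ ω).1 ∈ Set.Ioo (0 : ℝ) 1 ∧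
      (bitExchange S₁ S₂).transcript (Y₁ ω) (Y₂ ω) n = h
  · obtain ⟨ω₀, h1, h2, rfl⟩ := hex
    set h := (bitExchange S₁ S₂).transcript (Y₁ ω₀) (Y₂ ω₀) n with hh
    -- A transcript of length l fixes l digits in all, hence a dyadic rectangle of area 2 ^ (-l),
    -- whose entropy term is l times its probability.
    have hae : (fun ω => (bitExchange S₁ S₂).transcript (Y₁ ω) (Y₂ ω) n) ⁻¹' {h} =ᵐ[μ]
        {ω | (Y₁ ω).1 ∈ dyadicIco ((h.length + 1) / 2) (dyadicFloor ((h.length + 1) / 2) (Y₁ ω₀).1) ∧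
          (Y₂ ω).1 ∈ dyadicIco (h.length / 2) (dyadicFloor (h.length / 2) (Y₂ ω₀).1)} := by
      filter_upwards [hI₁, hI₂] with ω h3 h4
      refine propext ?_
      change (bitExchange S₁ S₂).transcript (Y₁ ω) (Y₂ ω) n = h ↔ _ ∧ _
      rw [bitExchange_transcript_eq_iff h1.2 h3.2 h2.2 h4.2, mem_dyadicIco, mem_dyadicIco,
        and_iff_right h3.1.le, and_iff_right h4.1.le]
    have hμ : μ ((fun ω => (bitExchange S₁ S₂).transcript (Y₁ ω) (Y₂ ω) n) ⁻¹' {h})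
        = ENNReal.ofReal ((1 / 2) ^ h.length) := by
      rw [measure_congr hae, measure_dyadicIco_inter hY₁ hY₂ hind hU₁ hU₂ (dyadicFloor_lt h1.2)
        (dyadicFloor_lt h2.2), show (h.length + 1) / 2 + h.length / 2 = h.length by omega]
    rw [Measure.real, hμ, ENNReal.toReal_ofReal (by positivity), bitsOf_half_pow]
  · have hμ : μ ((fun ω => (bitExchange S₁ S₂).transcript (Y₁ ω) (Y₂ ω) n) ⁻¹' {h}) = 0 := by
      refine measure_eq_zero_iff_ae_notMem.2 ?_
      filter_upwards [hI₁, hI₂] with ω h1 h2 hω using hex ⟨ω, h1, h2, hω⟩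
    rw [Measure.real, hμ, ENNReal.toReal_zero, bitsOf_zero, mul_zero]

/-- The sum rate of the bit-exchange protocol is the average number of bits sent. -/
theorem bitExchange_sumRate [IsProbabilityMeasure μ] (hY₁ : Measurable Y₁)
    (hY₂ : Measurable Y₂) (hind : IndepFun Y₁ Y₂ μ)
    (hU₁ : μ.map (fun ω => (Y₁ ω).1) = volume.restrict (Set.Ioo 0 1))
    (hU₂ : μ.map (fun ω => (Y₂ ω).1) = volume.restrict (Set.Ioo 0 1)) :
    (bitExchange S₁ S₂).sumRate μ Y₁ Y₂ = 4 := by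
  rw [Protocol.sumRate_eq_iSup_entropyOf _ hY₁ hY₂ hind
    (Filter.Eventually.of_forall fun ω n => rfl),
    ← lintegral_bitExchange_numMessages hY₁ hY₂ hind hU₁ hU₂]
  simp_rw [entropyOf_bitExchange_transcript hY₁ hY₂ hind hU₁ hU₂]
  unfold Protocol.numMessages
  -- Monotone convergence: the transcript lengths increase to the total number of messages.
  refine (lintegral_iSup (fun n => ?_) (monotone_nat_of_le_succ fun n ω => ?_)).symm
  · have hm := measurable_top_of_countable
      ((bitExchange S₁ S₂).measurableSet_transcript_eq hY₁ hY₂ n)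
    have hl : @Measurable (List ℕ) ℝ≥0∞ ⊤ _ (fun h => (h.length : ℝ≥0∞)) := fun _ _ => trivial
    exact hl.comp hm
  · rw [Nat.cast_le, Protocol.transcript_succ, List.length_append]
    exact Nat.le_add_left _ _

end Average

end MinComm

end

theorem mainTheorem1 {Ω S₁ S₂ : Type*}
    [MeasurableSpace Ω] [MeasurableSpace S₁] [MeasurableSpace S₂]
    (μ : Measure Ω) [IsProbabilityMeasure μ]
    (X₁ X₂ : Ω → ℝ) (W₁ : Ω → S₁) (W₂ : Ω → S₂)
    (hX₁ : Measurable X₁) (hX₂ : Measurable X₂) (hW₁ : Measurable W₁) (hW₂ : Measurable W₂)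
    (hU₁ : pdf.IsUniform X₁ (Set.Ioo 0 1) μ volume)
    (hU₂ : pdf.IsUniform X₂ (Set.Ioo 0 1) μ volume)
    (hXW₁ : IndepFun X₁ W₁ μ) (hXW₂ : IndepFun X₂ W₂ μ)
    (hind : IndepFun (fun ω => (X₁ ω, W₁ ω)) (fun ω => (X₂ ω, W₂ ω)) μ) :
    -- every zero-error protocol has sum rate at least four
    (∀ P : MinComm.Protocol (ℝ × S₁) (ℝ × S₂),
      P.ZeroError μ (fun ω => (X₁ ω, W₁ ω)) (fun ω => (X₂ ω, W₂ ω)) (fun ω => X₂ ω ≤ X₁ ω) →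
        4 ≤ P.sumRate μ (fun ω => (X₁ ω, W₁ ω)) (fun ω => (X₂ ω, W₂ ω))) ∧
    -- every zero-error rectangular partition has entropy at least four
    (∀ R : MinComm.RectPartition, R.ZeroError → 4 ≤ R.entropy) ∧
    -- the bit-exchange protocol has no error, sum rate four, and sends four bits on average
    ((MinComm.bitExchange S₁ S₂).ZeroError μ
        (fun ω => (X₁ ω, W₁ ω)) (fun ω => (X₂ ω, W₂ ω)) (fun ω => X₂ ω ≤ X₁ ω) ∧
      (MinComm.bitExchange S₁ S₂).sumRate μ
        (fun ω => (X₁ ω, W₁ ω)) (fun ω => (X₂ ω, W₂ ω)) = 4 ∧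
      ∫⁻ ω, (MinComm.bitExchange S₁ S₂).numMessages (X₁ ω, W₁ ω) (X₂ ω, W₂ ω) ∂μ = 4) ∧
    -- the minima are four
    IsLeast {c : ℝ≥0∞ | ∃ P : MinComm.Protocol (ℝ × S₁) (ℝ × S₂),
      P.ZeroError μ (fun ω => (X₁ ω, W₁ ω)) (fun ω => (X₂ ω, W₂ ω)) (fun ω => X₂ ω ≤ X₁ ω) ∧
        P.sumRate μ (fun ω => (X₁ ω, W₁ ω)) (fun ω => (X₂ ω, W₂ ω)) = c} 4 ∧
    IsLeast {c : ℝ≥0∞ | ∃ R : MinComm.RectPartition, R.ZeroError ∧ R.entropy = c} 4 := by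

  have hY₁ : Measurable fun ω => (X₁ ω, W₁ ω) := hX₁.prodMk hW₁
  have hY₂ : Measurable fun ω => (X₂ ω, W₂ ω) := hX₂.prodMk hW₂
  have hmap : ∀ {X : Ω → ℝ}, pdf.IsUniform X (Set.Ioo 0 1) μ volume →
      μ.map X = volume.restrict (Set.Ioo 0 1) := by
    intro X hU
    -- The interval has length 1, so conditioning on it is plain restriction.
    rw [hU, ProbabilityTheory.cond, Real.volume_Ioo]
    simp
  have hV₁ := hmap hU₁
  have hV₂ := hmap hU₂
  have hlower : ∀ P : MinComm.Protocol (ℝ × S₁) (ℝ × S₂),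
      P.ZeroError μ (fun ω => (X₁ ω, W₁ ω)) (fun ω => (X₂ ω, W₂ ω)) (fun ω => X₂ ω ≤ X₁ ω) →
        4 ≤ P.sumRate μ (fun ω => (X₁ ω, W₁ ω)) (fun ω => (X₂ ω, W₂ ω)) := fun P hP =>
    P.four_le_sumRate hY₁ hY₂ hind measurable_fst measurable_fst hV₁ hV₂ hP
  have hzero := MinComm.bitExchange_zeroError hY₁ hY₂ hind hV₁ hV₂
  have hrate := MinComm.bitExchange_sumRate hY₁ hY₂ hind hV₁ hV₂
  refine ⟨hlower, fun R hR => R.four_le_entropy hR,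
    ⟨hzero, hrate, MinComm.lintegral_bitExchange_numMessages hY₁ hY₂ hind hV₁ hV₂⟩,
    ⟨⟨_, hzero, hrate⟩, ?_⟩,
    ⟨_, MinComm.dyadicPartition_zeroError, MinComm.dyadicPartition_entropy⟩, ?_⟩
  · rintro c ⟨P, hP, rfl⟩
    exact hlower P hP
  · rintro c ⟨R, hR, rfl⟩
    exact R.four_le_entropy hR
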